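/- Let $p>2$, and let $\gamma$ be a real number with $\gamma=0$ if $2<p\le 3$ and $\gamma>p-3$ if $p>3$. Then there is a finite constant $C$, depending only on $p$ and $\gamma$, such that the following holds. Let $(\Omega,\mathcal A,\mathbb P)$ be a probability space, $T:\Omega\to\Omega$ a bijective bimeasurable transformation preserving $\mathbb P$, and $\mathcal F_0\subseteq\mathcal A$ a $\sigma$-algebra with $\mathcal F_0\subseteq T^{-1}(\mathcal F_0)$. Put $\mathcal F_k=T^{-k}(\mathcal F_0)$ and $\mathbb E_k(\cdot)=\mathbb E(\cdot\mid\mathcal F_k)$. Let $X_0$ be a real-valued random variable with $\|X_0\|_p=(\mathbb E|X_0|^p)^{1/p}<\infty$ (not assumed $\mathcal F_0$-measurable), and let $X_k=X_0\circ T^k$ and $S_n=X_1+\cdots+X_n$. For $j\ge 1$ let $$A(X,j)=\max\Big(2\sup_{i\ge 0}\|\mathbb E_0(X_iX_{j+i})\|_{p/2},\ \sup_{0\le i\le j}\|\mathbb E_0(X_jX_{j+i})-\mathbb E(X_jX_{j+i})\|_{p/2}\Big).$$ Then, for every positive integer $n$, $$\Big\|\max_{1\le j\le n}|S_j|\Big\|_p\le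 C\bigg[n^{1/2}\Big(\sum_{k=0}^{n-1}|\mathbb E(X_0X_k)|\Big)^{1/2}+n^{1/p}\|X_1\|_p+n^{1/p}\sum_{k=1}^{n}\frac{\|\mathbb E_0(X_k)\|_p}{k^{1/p}}+n^{1/p}\sum_{k=1}^{2n}\frac{\|X_0-\mathbb E_k(X_0)\|_p}{k^{1/p}}+n^{1/p}\Big(\sum_{k=1}^{n}\frac{(\log k)^{\gamma}}{k^{(2/p)-1}}A(X,k)\Big)^{1/2}\bigg],$$ where $(\log 1)^{\gamma}$ is read as $1$ if $\gamma=0$ and as $0$ if $\gamma>0$. -/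

import Mathlib

open MeasureTheory
open scoped ENNReal NNReal

universe u

noncomputable section

namespace StationaryMax

variable {Ω : Type*}

/-- The stationary sequence `X_k = X_0 ∘ T^k` (only indices `k ≥ 0` are needed). -/
def seq (T : Ω → Ω) (X₀ : Ω → ℝ) (k : ℕ) : Ω → ℝ :=
  fun ω => X₀ (T^[k] ω)

/-- The partial sum `S_n = X_1 + ⋯ + X_n`. -/
def partialSum (T : Ω → Ω) (X₀ : Ω → ℝ) (n : ℕ) : Ω → ℝ :=
  fun ω => ∑ k ∈ Finset.Icc 1 n, seq T X₀ k ω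

/-- The random variable `max_{1 ≤ j ≤ n} |S_j|`, for `n ≥ 1`. -/
def maxAbsPartialSum (T : Ω → Ω) (X₀ : Ω → ℝ) (n : ℕ) (hn : 1 ≤ n) : Ω → ℝ :=
  fun ω => (Finset.Icc 1 n).sup' (Finset.nonempty_Icc.2 hn) fun j => |partialSum T X₀ j ω|

/-- The σ-algebra `F_k = T^{-k}(F_0)`. -/
abbrev pastSigma (T : Ω → Ω) (F₀ : MeasurableSpace Ω) (k : ℕ) : MeasurableSpace Ω :=
  F₀.comap T^[k]

/-- The norm `‖f‖_p = (E |f|^p)^{1/p}`, for a real exponent `p > 0`, with values in `[0, ∞]`. -/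
def normLp {_mΩ : MeasurableSpace Ω} (μ : Measure Ω) (p : ℝ) (f : Ω → ℝ) : ℝ≥0∞ :=
  eLpNorm f (ENNReal.ofReal p) μ

/-- The coefficient `A(X, j)`: the maximum of `2 sup_{i ≥ 0} ‖E_0(X_i X_{j+i})‖_{p/2}` and
`sup_{0 ≤ i ≤ j} ‖E_0(X_j X_{j+i}) - E(X_j X_{j+i})‖_{p/2}`. -/
def coeffA (T : Ω → Ω) (F₀ : MeasurableSpace Ω) {_mΩ : MeasurableSpace Ω} (μ : Measure Ω)
    (p : ℝ) (X₀ : Ω → ℝ) (j : ℕ) : ℝ≥0∞ :=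
  max
    (2 * ⨆ i : ℕ, normLp μ (p / 2) (μ[fun ω => seq T X₀ i ω * seq T X₀ (j + i) ω | F₀]))
    (⨆ (i : ℕ) (_ : i ≤ j), normLp μ (p / 2) fun ω =>
      (μ[fun ω' => seq T X₀ j ω' * seq T X₀ (j + i) ω' | F₀]) ω
        - ∫ ω', seq T X₀ j ω' * seq T X₀ (j + i) ω' ∂μ)

end StationaryMax

end

/-! Write `N = 2^R` for the least power of two with `n ≤ N`. The maximum is reduced to norms of
dyadic sums by S_m = E(S_N | F_m) - E(S_N - S_m | F_m) + (S_m - E(S_m | F_m)). Doob's inequality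
controls the initial term. In the other two, S_N - S_m and S_m are cut into aligned dyadic blocks,
at most one of each length 2^l. The blocks of one length are dominated together by an ℓ^p norm, so
by stationarity and Doob's inequality that scale costs 2^{(R-l)/p} times ‖E_0 S_{2^l}‖_p or ‖S_{2^l}
- E(S_{2^l} | F_{2^l})‖_p (`lpNorm_maxAbsPartialSum_le`).

To bound ‖S_N‖_p, write S_{2k} = U + V + (S_k - U) with U = E(S_k | F_k) and V = S_k ∘ T^k. A second
order expansion of |U + V|^p, with V and V² conditioned on F_k, bounds ‖S_{2k}‖_p through ‖S_k‖_p,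
‖E_0 S_k‖_p, ‖E_0 S_k²‖_{p/2} and ‖S_k - U‖_p (`lpNorm_partialSum_double_le`). If p > 3 the
expansion also leaves |U| |V|^{p-1}. It is absorbed by ε|V|^p at the price of a weight w ≥
ε^{-(p-3)} on |U|^{p-2} V².

After division by 2^{l/p}, the factor of the main term is 1 + ε_l/2 at scale l. Bounding every
moment by the largest one solves the recurrence as soon as ∑ ε_l ≤ 1 (`le_of_dyadic_recurrence`).
With ε_l of order l^{-γ/(p-3)}, summable because γ > p - 3, the weight is l^γ, which becomes the
factor (log k)^γ. An extra geometric part in ε_l keeps this logarithm away from the covariance term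
(`exists_absorbing_weights`).

Expanding S_k² and separating each E_0(X_a X_{a+i}) into its mean and a centred part bounds ‖E_0
S_k²‖_{p/2} by k ∑ |E(X_0 X_i)| + ∑ j A(X, j), up to constants (`lpNorm_condExp_partialSum_sq_le`).
Interchanging the dyadic sum with the sum over j gives the series of the theorem. -/

namespace StationaryMax

/-! ### Real-valued L^p norms and conditional expectations. -/

section LpBasics

variable {Ω : Type*} {mΩ : MeasurableSpace Ω} {μ : Measure Ω}

lemma integral_abs_rpow_eq {f : Ω → ℝ} {p : ℝ} (hp : 0 < p)
    (hf : AEStronglyMeasurable f μ) :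
    ∫ ω, |f ω| ^ p ∂μ = lpNorm f (ENNReal.ofReal p) μ ^ p := by
  rw [lpNorm_eq_integral_norm_rpow_toReal (by simpa using hp) (by simp) hf,
    ENNReal.toReal_ofReal hp.le, ← Real.rpow_mul (by positivity), inv_mul_cancel₀ hp.ne',
    Real.rpow_one]
  simp [Real.norm_eq_abs]

lemma integrable_abs_rpow {f : Ω → ℝ} {p : ℝ} (hp : 0 < p)
    (hf : MemLp f (ENNReal.ofReal p) μ) : Integrable (fun ω => |f ω| ^ p) μ := by
  have := hf.integrable_norm_rpow (by simpa using hp) (by simp)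
  simpa [ENNReal.toReal_ofReal hp.le] using this

lemma lpNorm_le_of_integral_le {f : Ω → ℝ} {p c : ℝ} (hp : 0 < p) (hc : 0 ≤ c)
    (hf : AEStronglyMeasurable f μ) (h : ∫ ω, |f ω| ^ p ∂μ ≤ c ^ p) :
    lpNorm f (ENNReal.ofReal p) μ ≤ c := by
  rw [integral_abs_rpow_eq hp hf] at h
  exact (Real.rpow_le_rpow_iff lpNorm_nonneg hc hp).1 h

lemma lpNorm_mono_ae {f g : Ω → ℝ} {P : ℝ≥0∞} (hg : MemLp g P μ)
    (h : ∀ᵐ ω ∂μ, |f ω| ≤ g ω) : lpNorm f P μ ≤ lpNorm g P μ := by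
  by_cases hf : AEStronglyMeasurable f μ
  · rw [← toReal_eLpNorm hf, ← toReal_eLpNorm hg.aestronglyMeasurable]
    exact ENNReal.toReal_mono hg.eLpNorm_ne_top (eLpNorm_mono_ae_real h)
  · simp [hf]

lemma lpNorm_congr_ae {f g : Ω → ℝ} {P : ℝ≥0∞} (h : f =ᵐ[μ] g) :
    lpNorm f P μ = lpNorm g P μ := by
  by_cases hf : AEStronglyMeasurable f μ
  · rw [← toReal_eLpNorm hf, ← toReal_eLpNorm (hf.congr h), eLpNorm_congr_ae h]
  · rw [lpNorm_of_not_aestronglyMeasurable hf,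
      lpNorm_of_not_aestronglyMeasurable fun hg => hf (hg.congr h.symm)]

/-- Hölder's inequality in the form `E(|U|^{p-s} |B|) ≤ ‖U‖_p^{p-s} ‖B‖_{p/s}`. -/
lemma integral_rpow_mul_le {U B : Ω → ℝ} {p s : ℝ} (hs : 0 < s) (hsp : s < p)
    (hU : MemLp U (ENNReal.ofReal p) μ) (hB : MemLp B (ENNReal.ofReal (p / s)) μ) :
    Integrable (fun ω => |U ω| ^ (p - s) * |B ω|) μ ∧
      ∫ ω, |U ω| ^ (p - s) * |B ω| ∂μ ≤
        lpNorm U (ENNReal.ofReal p) μ ^ (p - s) * lpNorm B (ENNReal.ofReal (p / s)) μ := by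
  have hp : 0 < p := hs.trans hsp
  have hps : 0 < p - s := by linarith
  have hconj : (p / (p - s)).HolderConjugate (p / s) := by
    rw [Real.holderConjugate_iff]
    constructor
    · rw [one_lt_div hps]; linarith
    · field_simp; ring
  have hU' : MemLp (fun ω => |U ω| ^ (p - s)) (ENNReal.ofReal (p / (p - s))) μ := by
    have := hU.norm_rpow_div (ENNReal.ofReal (p - s))
    rw [ENNReal.toReal_ofReal hps.le, ← ENNReal.ofReal_div_of_pos hps] at this
    simpa using this
  have hnorm : ∀ ω, ‖|U ω| ^ (p - s)‖ = |U ω| ^ (p - s) := fun ω => by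
    rw [Real.norm_eq_abs, abs_of_nonneg (by positivity)]
  have : ENNReal.HolderConjugate (ENNReal.ofReal (p / (p - s))) (ENNReal.ofReal (p / s)) :=
    hconj.ennrealOfReal
  constructor
  · exact hU'.integrable_mul hB.norm
  · have h := integral_mul_norm_le_Lp_mul_Lq hconj hU' hB
    simp only [hnorm] at h
    refine h.trans (le_of_eq ?_)
    congr 1
    · have : ∀ ω, (|U ω| ^ (p - s)) ^ (p / (p - s)) = |U ω| ^ p := fun ω => by
        rw [← Real.rpow_mul (abs_nonneg _)]; congr 1; field_simp
      simp only [this]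
      rw [integral_abs_rpow_eq hp hU.1, ← Real.rpow_mul lpNorm_nonneg]
      congr 1; field_simp
    · have := integral_abs_rpow_eq (div_pos hp hs) hB.1
      simp only [Real.norm_eq_abs]
      rw [this, ← Real.rpow_mul lpNorm_nonneg, mul_one_div_cancel (div_pos hp hs).ne',
        Real.rpow_one]

lemma lpNorm_comp_measurePreserving {f : Ω → ℝ} {T : Ω → Ω} {P : ℝ≥0∞}
    (hT : MeasurePreserving T μ μ) (hf : AEStronglyMeasurable f μ) :
    lpNorm (fun ω => f (T ω)) P μ = lpNorm f P μ := by
  have h : AEStronglyMeasurable (f ∘ T) μ := hf.comp_measurePreserving hT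
  have h2 := eLpNorm_comp_measurePreserving (p := P) hf hT
  rw [← toReal_eLpNorm hf, ← h2, toReal_eLpNorm h]
  rfl

end LpBasics

/-- Conditional expectations commute with a measure preserving transformation. -/
lemma condExp_comp_measurePreserving {Ω : Type*} {m mΩ : MeasurableSpace Ω}
    {μ : Measure Ω} [IsFiniteMeasure μ] {f : Ω → ℝ} {T : Ω → Ω} (hm : m ≤ mΩ) (hT : MeasurePreserving T μ μ) (hf : Integrable f μ) :
    μ[fun ω => f (T ω) | m.comap T] =ᵐ[μ] fun ω => (μ[f | m]) (T ω) := by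
  have hle : m.comap T ≤ mΩ := by
    rintro _ ⟨s, hs, rfl⟩
    exact hT.measurable (hm s hs)
  have key : ∀ g : Ω → ℝ, Integrable g μ → ∀ s, MeasurableSet[m] s →
      ∫ ω in T ⁻¹' s, g (T ω) ∂μ = ∫ ω in s, g ω ∂μ := by
    intro g hg s hs
    have h1 : AEStronglyMeasurable g (μ.map T) := by rw [hT.map_eq]; exact hg.1
    have := setIntegral_map (hm s hs) h1 hT.measurable.aemeasurable
    rw [← this, hT.map_eq]
  symm
  refine ae_eq_condExp_of_forall_setIntegral_eq hle (hT.integrable_comp_of_integrable hf) ?_ ?_ ?_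
  · intro s _ _
    exact (hT.integrable_comp_of_integrable integrable_condExp).integrableOn
  · rintro _ ⟨s, hs, rfl⟩ _
    rw [key _ integrable_condExp s hs, key f hf s hs, setIntegral_condExp hm hf hs]
  · refine StronglyMeasurable.aestronglyMeasurable ?_
    exact stronglyMeasurable_condExp.comp_measurable (comap_measurable T)

/-- Testing a conditional expectation against a measurable weight. -/
lemma integral_mul_condExp {Ω : Type*} {m mΩ : MeasurableSpace Ω} {μ : Measure Ω}
    [IsFiniteMeasure μ] {W Z : Ω → ℝ} (hm : m ≤ mΩ) (hW : StronglyMeasurable[m] W) (hWZ : Integrable (fun ω => W ω * Z ω) μ)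
    (hZ : Integrable Z μ) : ∫ ω, W ω * (μ[Z | m]) ω ∂μ = ∫ ω, W ω * Z ω ∂μ := by
  have h := condExp_mul_of_stronglyMeasurable_left (μ := μ) hW hWZ hZ
  have h2 := integral_condExp (μ := μ) (f := W * Z) hm
  rw [integral_congr_ae h] at h2
  exact h2

/-- This is the pointwise increment of a running maximum `a` when a new value `b` arrives. For `a <
b`, Young's inequality gives a^{p-1} b ≤ (1 - 1/p) a^p + b^p / p, so the bracket is at least (1 -
1/p)(b^p - a^p); the factor 2 suffices because p ≥ 2. -/
lemma max_rpow_le_add {p a b : ℝ} (hp : 2 ≤ p) (ha : 0 ≤ a) (hb : 0 ≤ b) :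
    max a b ^ p ≤ a ^ p + 2 * ((max a b ^ (p - 1) - a ^ (p - 1)) * b) := by
  rcases le_total b a with h | h
  · simp [max_eq_left h]
  · rw [max_eq_right h]
    have hconj : (p / (p - 1)).HolderConjugate p := by
      rw [Real.holderConjugate_iff]
      constructor
      · rw [one_lt_div (by linarith)]; linarith
      · have : p - 1 ≠ 0 := by linarith
        field_simp; ring
    have hy := Real.young_inequality_of_nonneg (Real.rpow_nonneg ha (p - 1)) hb hconj
    rw [← Real.rpow_mul ha, mul_div_cancel₀ _ (by linarith : p - 1 ≠ 0)] at hy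
    have h1 : b ^ (p - 1) * b = b ^ p := by
      rw [← Real.rpow_add_one' hb (by linarith)]; congr 1; ring
    have h2 : a ^ p ≤ b ^ p := Real.rpow_le_rpow ha h (by linarith)
    have h3 : a ^ p / (p / (p - 1)) + b ^ p / p = a ^ p - (a ^ p) / p + b ^ p / p := by
      have : p ≠ 0 := by linarith
      have : p - 1 ≠ 0 := by linarith
      field_simp
    have h4 : (b ^ p - a ^ p) / p ≤ (b ^ p - a ^ p) / 2 :=
      div_le_div_of_nonneg_left (by linarith) (by norm_num) hp
    rw [sub_div, sub_div] at h4
    rw [h3] at hy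
    nlinarith

/-- `max_{k ≤ n} |E(|Z| ∣ F_k)|`. -/
noncomputable def condMax {Ω : Type*} {_mΩ : MeasurableSpace Ω} (μ : Measure Ω)
    (F : ℕ → MeasurableSpace Ω) (Z : Ω → ℝ) (n : ℕ) : Ω → ℝ :=
  partialSups (fun k ω => |(μ[fun ω' => |Z ω'| | F k]) ω|) n

/-! ### Doob's maximal inequality. -/

section Doob

variable {Ω : Type*} {F : ℕ → MeasurableSpace Ω} {mΩ : MeasurableSpace Ω} {μ : Measure Ω}
  {Z : Ω → ℝ} {p : ℝ}

lemma condMax_succ (n : ℕ) (ω : Ω) : condMax μ F Z (n + 1) ω =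
    max (condMax μ F Z n ω) |(μ[fun ω' => |Z ω'| | F (n + 1)]) ω| := by
  simp [condMax, partialSups_add_one]

lemma le_condMax {k n : ℕ} (hk : k ≤ n) (ω : Ω) :
    |(μ[fun ω' => |Z ω'| | F k]) ω| ≤ condMax μ F Z n ω :=
  le_partialSups_of_le (fun k ω => |(μ[fun ω' => |Z ω'| | F k]) ω|) hk ω

lemma condMax_nonneg (n : ℕ) (ω : Ω) : 0 ≤ condMax μ F Z n ω :=
  (abs_nonneg _).trans (le_condMax (Nat.zero_le n) ω)

lemma abs_condExp_le_condMax {k n : ℕ} (hk : k ≤ n) :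
    ∀ᵐ ω ∂μ, |(μ[Z | F k]) ω| ≤ condMax μ F Z n ω := by
  filter_upwards [norm_condExp_le (μ := μ) (m := F k) Z] with ω h
  exact (h.trans (le_abs_self _)).trans (le_condMax hk ω)

lemma condMax_stronglyMeasurable (hF : Monotone F) (n : ℕ) :
    StronglyMeasurable[F n] (condMax μ F Z n) := by
  have hc : ∀ k, StronglyMeasurable[F k] fun ω => |(μ[fun ω' => |Z ω'| | F k]) ω| := fun k =>
    continuous_abs.comp_stronglyMeasurable stronglyMeasurable_condExp
  induction n with
  | zero => exact hc 0
  | succ n ih =>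
    have : condMax μ F Z (n + 1) = (condMax μ F Z n) ⊔
        fun ω => |(μ[fun ω' => |Z ω'| | F (n + 1)]) ω| := by
      ext ω; exact condMax_succ n ω
    rw [this]
    have h : StronglyMeasurable[F (n + 1)] (condMax μ F Z n) := ih.mono (hF n.le_succ)
    exact @StronglyMeasurable.sup _ _ _ _ (F (n + 1)) _ _ _ h (hc (n + 1))

lemma memLp_condMax {P : ℝ≥0∞} (hP : 1 ≤ P) (hZ : MemLp Z P μ) (n : ℕ) :
    MemLp (condMax μ F Z n) P μ := by
  induction n with
  | zero => exact (hZ.abs.condExp hP).abs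
  | succ n ih =>
    have : condMax μ F Z (n + 1) = (condMax μ F Z n) ⊔
        fun ω => |(μ[fun ω' => |Z ω'| | F (n + 1)]) ω| := by
      ext ω; exact condMax_succ n ω
    rw [this]
    exact ih.sup (hZ.abs.condExp hP).abs

lemma integral_mul_abs_condExp [IsFiniteMeasure μ] {W : Ω → ℝ} {k : ℕ} (hle : F k ≤ mΩ)
    (hW : StronglyMeasurable[F k] W) (hWZ : Integrable (fun ω => W ω * |Z ω|) μ)
    (hZ : Integrable Z μ) :
    ∫ ω, W ω * |(μ[fun ω' => |Z ω'| | F k]) ω| ∂μ = ∫ ω, W ω * |Z ω| ∂μ := by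
  rw [← integral_mul_condExp hle hW hWZ hZ.abs]
  refine integral_congr_ae ?_
  have h0 : 0 ≤ᵐ[μ] fun ω' => |Z ω'| := Filter.Eventually.of_forall fun ω => abs_nonneg _
  filter_upwards [condExp_nonneg (m := F k) h0] with ω h
  rw [abs_of_nonneg h]

/-- With M_n the running maximum and f_{n+1} = E(|Z| | F_{n+1}), M_{n+1}^p - M_n^p is at most 2
(M_{n+1}^{p-1} - M_n^{p-1}) f_{n+1}. The bracket is F_{n+1}-measurable, so under the integral
f_{n+1} may be replaced by |Z|, and the increments telescope. -/
lemma integral_condMax_rpow_le [IsFiniteMeasure μ] (hF : Monotone F) (hle : ∀ k, F k ≤ mΩ)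
    (hp : 2 ≤ p) (hZ : MemLp Z (ENNReal.ofReal p) μ) (n : ℕ) :
    ∫ ω, condMax μ F Z n ω ^ p ∂μ ≤ 2 * ∫ ω, condMax μ F Z n ω ^ (p - 1) * |Z ω| ∂μ := by
  have hp1 : 1 ≤ ENNReal.ofReal p := by simpa using (by linarith : 1 ≤ p)
  have hZi : Integrable Z μ := hZ.integrable hp1
  have hM : ∀ n, MemLp (condMax μ F Z n) (ENNReal.ofReal p) μ := memLp_condMax hp1 hZ
  have hint : ∀ n, Integrable (fun ω => condMax μ F Z n ω ^ p) μ := fun n => by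
    simpa [abs_of_nonneg (condMax_nonneg n _)] using integrable_abs_rpow (by linarith) (hM n)
  have hmul : ∀ n (B : Ω → ℝ), MemLp B (ENNReal.ofReal p) μ →
      Integrable (fun ω => condMax μ F Z n ω ^ (p - 1) * |B ω|) μ := fun n B hB => by
    have := (integral_rpow_mul_le (s := 1) one_pos (by linarith) (hM n) (by simpa using hB)).1
    simpa [abs_of_nonneg (condMax_nonneg n _)] using this
  have hf : ∀ k, MemLp (fun ω => (μ[fun ω' => |Z ω'| | F k]) ω) (ENNReal.ofReal p) μ :=
    fun k => hZ.abs.condExp hp1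
  have hsm : ∀ n, StronglyMeasurable[F n] fun ω => condMax μ F Z n ω ^ (p - 1) := fun n =>
    (Real.continuous_rpow_const (by linarith)).comp_stronglyMeasurable
      (condMax_stronglyMeasurable hF n)
  induction n with
  | zero =>
    have h0 := integral_mul_abs_condExp (hle 0) (hsm 0) (hmul 0 Z hZ) hZi
    have h1 : ∀ ω, condMax μ F Z 0 ω ^ p =
        condMax μ F Z 0 ω ^ (p - 1) * |(μ[fun ω' => |Z ω'| | F 0]) ω| := fun ω => by
      have : condMax μ F Z 0 ω = |(μ[fun ω' => |Z ω'| | F 0]) ω| := rfl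
      rw [← this, ← Real.rpow_add_one' (condMax_nonneg 0 ω) (by linarith)]
      congr 1; ring
    simp_rw [h1]
    rw [h0]
    have : 0 ≤ ∫ ω, condMax μ F Z 0 ω ^ (p - 1) * |Z ω| ∂μ :=
      integral_nonneg fun ω => mul_nonneg (Real.rpow_nonneg (condMax_nonneg _ _) _) (abs_nonneg _)
    linarith
  | succ n ih =>
    set f := fun ω => (μ[fun ω' => |Z ω'| | F (n + 1)]) ω with hfdef
    have hpt : ∀ ω, condMax μ F Z (n + 1) ω ^ p ≤ condMax μ F Z n ω ^ p +
        2 * (condMax μ F Z (n + 1) ω ^ (p - 1) * |f ω| - condMax μ F Z n ω ^ (p - 1) * |f ω|) := by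
      intro ω
      rw [← sub_mul, condMax_succ]
      exact max_rpow_le_add hp (condMax_nonneg n ω) (abs_nonneg _)
    have h1 := integral_mul_abs_condExp (hle (n + 1)) (hsm (n + 1)) (hmul (n + 1) Z hZ) hZi
    have h2 := integral_mul_abs_condExp (hle (n + 1)) ((hsm n).mono (hF n.le_succ))
      (hmul n Z hZ) hZi
    have hI1 := hmul (n + 1) f (hf (n + 1))
    have hI2 := hmul n f (hf (n + 1))
    have := integral_mono (hint (n + 1)) ((hint n).add ((hI1.sub hI2).const_mul 2)) hpt
    rw [integral_add' (hint n) ((hI1.sub hI2).const_mul 2), integral_const_mul,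
      integral_sub' hI1 hI2] at this
    linarith

/-- Doob's maximal inequality in `L^p`. -/
lemma lpNorm_condMax_le [IsFiniteMeasure μ] (hF : Monotone F) (hle : ∀ k, F k ≤ mΩ)
    (hp : 2 ≤ p) (hZ : MemLp Z (ENNReal.ofReal p) μ) (n : ℕ) :
    lpNorm (condMax μ F Z n) (ENNReal.ofReal p) μ ≤ 2 * lpNorm Z (ENNReal.ofReal p) μ := by
  have hp1 : 1 ≤ ENNReal.ofReal p := by simpa using (by linarith : 1 ≤ p)
  have hM : MemLp (condMax μ F Z n) (ENNReal.ofReal p) μ := memLp_condMax hp1 hZ n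
  have h := integral_condMax_rpow_le hF hle hp hZ n
  have h1 := integral_abs_rpow_eq (by linarith : 0 < p) hM.1
  have h2 := (integral_rpow_mul_le (s := 1) one_pos (by linarith) hM (by simpa using hZ)).2
  simp only [abs_of_nonneg (condMax_nonneg n _), div_one] at h1 h2
  rw [h1] at h
  set N := lpNorm (condMax μ F Z n) (ENNReal.ofReal p) μ with hN
  have hN0 : 0 ≤ N := lpNorm_nonneg
  rcases hN0.eq_or_lt with h0 | h0
  · rw [← h0]; exact mul_nonneg zero_le_two lpNorm_nonneg
  · have h3 : N ^ p = N ^ (p - 1) * N := by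
      rw [← Real.rpow_add_one h0.ne']; congr 1; ring
    have h4 : 0 < N ^ (p - 1) := Real.rpow_pos_of_pos h0 _
    refine le_of_mul_le_mul_left ?_ h4
    linarith

end Doob

/-- The pointwise `ℓ^p` norm of a finite family of random variables. -/
noncomputable def lpSum {Ω ι : Type*} (p : ℝ) (s : Finset ι) (Z : ι → Ω → ℝ) : Ω → ℝ :=
  fun ω => (∑ i ∈ s, |Z i ω| ^ p) ^ (1 / p)

/-! ### Maxima over blocks replaced by ℓ^p norms. -/

section LpSum

variable {Ω ι : Type*} {mΩ : MeasurableSpace Ω} {μ : Measure Ω} {p : ℝ} {s : Finset ι}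
  {Z : ι → Ω → ℝ}

lemma lpSum_nonneg (ω : Ω) : 0 ≤ lpSum p s Z ω := by unfold lpSum; positivity

lemma lpSum_rpow (hp : 0 < p) (ω : Ω) : lpSum p s Z ω ^ p = ∑ i ∈ s, |Z i ω| ^ p := by
  rw [lpSum, ← Real.rpow_mul (by positivity), one_div_mul_cancel hp.ne', Real.rpow_one]

lemma abs_le_lpSum (hp : 0 < p) {i : ι} (hi : i ∈ s) (ω : Ω) : |Z i ω| ≤ lpSum p s Z ω := by
  rw [← Real.rpow_le_rpow_iff (abs_nonneg _) (lpSum_nonneg ω) hp, lpSum_rpow hp]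
  exact Finset.single_le_sum (f := fun i => |Z i ω| ^ p) (fun j _ => by positivity) hi

lemma memLp_lpSum (hp : 0 < p) (hZ : ∀ i ∈ s, MemLp (Z i) (ENNReal.ofReal p) μ) :
    MemLp (lpSum p s Z) (ENNReal.ofReal p) μ := by
  have hm : AEStronglyMeasurable (lpSum p s Z) μ := by
    refine (Real.continuous_rpow_const (by positivity)).comp_aestronglyMeasurable ?_
    refine Finset.aestronglyMeasurable_fun_sum _ fun i hi => ?_
    exact (integrable_abs_rpow hp (hZ i hi)).1
  rw [← integrable_norm_rpow_iff hm (by simpa using hp) (by simp)]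
  simp only [Real.norm_eq_abs, abs_of_nonneg (lpSum_nonneg _), ENNReal.toReal_ofReal hp.le,
    lpSum_rpow hp]
  exact integrable_finsetSum _ fun i hi => integrable_abs_rpow hp (hZ i hi)

/-- No independence is needed: summing p-th moments costs only the factor card^{1/p}, the source of
the powers 2^{(r-l)/p} in the chaining. -/
lemma lpNorm_lpSum_le (hp : 0 < p) (hZ : ∀ i ∈ s, MemLp (Z i) (ENNReal.ofReal p) μ) {v : ℝ}
    (hv : 0 ≤ v) (h : ∀ i ∈ s, lpNorm (Z i) (ENNReal.ofReal p) μ ≤ v) :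
    lpNorm (lpSum p s Z) (ENNReal.ofReal p) μ ≤ (s.card : ℝ) ^ (1 / p) * v := by
  refine lpNorm_le_of_integral_le hp (by positivity) (memLp_lpSum hp hZ).1 ?_
  simp only [abs_of_nonneg (lpSum_nonneg _), lpSum_rpow hp]
  rw [integral_finsetSum _ fun i hi => integrable_abs_rpow hp (hZ i hi),
    Real.mul_rpow (by positivity) hv, ← Real.rpow_mul (by positivity), one_div_mul_cancel hp.ne',
    Real.rpow_one, ← nsmul_eq_mul]
  refine Finset.sum_le_card_nsmul _ _ _ fun i hi => ?_
  rw [integral_abs_rpow_eq hp (hZ i hi).1]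
  exact Real.rpow_le_rpow lpNorm_nonneg (h i hi) hp.le

end LpSum

/-! ### Stationarity of the sums and of the filtration. -/

section Setup

variable {Ω : Type*} {F₀ mΩ : MeasurableSpace Ω} {μ : Measure Ω} {T : Ω → Ω} {X₀ : Ω → ℝ} {p : ℝ}

lemma pastSigma_zero : pastSigma T F₀ 0 = F₀ := MeasurableSpace.comap_id

lemma pastSigma_add (k m : ℕ) :
    pastSigma T F₀ (k + m) = (pastSigma T F₀ k).comap T^[m] := by
  simp only [pastSigma, MeasurableSpace.comap_comp, Function.iterate_add]

lemma pastSigma_mono (hF : F₀ ≤ F₀.comap T) : Monotone (pastSigma T F₀) := by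
  refine monotone_nat_of_le_succ fun k => ?_
  have h := MeasurableSpace.comap_mono (g := T^[k]) hF
  rwa [MeasurableSpace.comap_comp, ← Function.iterate_succ'] at h

lemma pastSigma_le (hT : MeasurePreserving T μ μ) (hle : F₀ ≤ mΩ) (k : ℕ) :
    pastSigma T F₀ k ≤ mΩ := by
  rintro _ ⟨s, hs, rfl⟩
  exact (hT.iterate k).measurable (hle s hs)

lemma condExp_shift [IsFiniteMeasure μ] (hT : MeasurePreserving T μ μ) (hle : F₀ ≤ mΩ)
    {f : Ω → ℝ} (hf : Integrable f μ) (k m : ℕ) :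
    μ[fun ω => f (T^[m] ω) | pastSigma T F₀ (k + m)] =ᵐ[μ]
      fun ω => (μ[f | pastSigma T F₀ k]) (T^[m] ω) := by
  rw [pastSigma_add]
  exact condExp_comp_measurePreserving (pastSigma_le hT hle k) (hT.iterate m) hf

lemma condExp_shift_zero [IsFiniteMeasure μ] (hT : MeasurePreserving T μ μ) (hle : F₀ ≤ mΩ)
    {f : Ω → ℝ} (hf : Integrable f μ) (m : ℕ) :
    μ[fun ω => f (T^[m] ω) | pastSigma T F₀ m] =ᵐ[μ] fun ω => (μ[f | F₀]) (T^[m] ω) := by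
  have := condExp_shift hT hle hf 0 m
  rwa [pastSigma_zero, zero_add] at this

lemma memLp_iterate {P : ℝ≥0∞} {f : Ω → ℝ} (hT : MeasurePreserving T μ μ) (hf : MemLp f P μ)
    (m : ℕ) : MemLp (fun ω => f (T^[m] ω)) P μ :=
  hf.comp_measurePreserving (hT.iterate m)

lemma memLp_partialSum {P : ℝ≥0∞} (hT : MeasurePreserving T μ μ) (hX : MemLp X₀ P μ) (n : ℕ) :
    MemLp (partialSum T X₀ n) P μ :=
  memLp_finsetSum _ fun k _ => memLp_iterate hT hX k

lemma partialSum_add (m k : ℕ) (ω : Ω) :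
    partialSum T X₀ (m + k) ω = partialSum T X₀ m ω + partialSum T X₀ k (T^[m] ω) := by
  simp only [partialSum, seq]
  induction k with
  | zero => simp
  | succ k ih =>
    rw [← add_assoc, Finset.sum_Icc_succ_top (by omega), ih, Finset.sum_Icc_succ_top (by omega),
      add_assoc, ← Function.iterate_add_apply, show k + 1 + m = m + k + 1 by ring]

lemma lpNorm_condExp_shift [IsFiniteMeasure μ] {P : ℝ≥0∞} (hT : MeasurePreserving T μ μ)
    (hle : F₀ ≤ mΩ) {f : Ω → ℝ} (hf : Integrable f μ) (m : ℕ) :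
    lpNorm (μ[fun ω => f (T^[m] ω) | pastSigma T F₀ m]) P μ = lpNorm (μ[f | F₀]) P μ := by
  rw [lpNorm_congr_ae (condExp_shift_zero hT hle hf m)]
  exact lpNorm_comp_measurePreserving (hT.iterate m) integrable_condExp.1

lemma lpNorm_sub_condExp_shift [IsFiniteMeasure μ] {P : ℝ≥0∞} (hT : MeasurePreserving T μ μ)
    (hle : F₀ ≤ mΩ) {f : Ω → ℝ} (hf : Integrable f μ) (k m : ℕ) :
    lpNorm (fun ω => f (T^[m] ω) -
        (μ[fun ω' => f (T^[m] ω') | pastSigma T F₀ (k + m)]) ω) P μ =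
      lpNorm (fun ω => f ω - (μ[f | pastSigma T F₀ k]) ω) P μ := by
  refine Eq.trans (lpNorm_congr_ae ?_)
    (lpNorm_comp_measurePreserving (hT.iterate m) (hf.1.sub integrable_condExp.1))
  filter_upwards [condExp_shift hT hle hf k m] with ω h
  rw [h]

end Setup

/-! ### Dyadic chaining and the reduction of the maximum. -/

section Maximal

variable {Ω : Type*} {F₀ mΩ : MeasurableSpace Ω} {μ : Measure Ω} {T : Ω → Ω} {X₀ : Ω → ℝ} {p : ℝ}

/-- The block sum `S_{(c+1) 2^l} - S_{c 2^l}`. -/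
noncomputable def block (T : Ω → Ω) (X₀ : Ω → ℝ) (l c : ℕ) : Ω → ℝ :=
  fun ω => partialSum T X₀ (2 ^ l) (T^[c * 2 ^ l] ω)

/-- Dominates the conditional expectations of the blocks of length `2^l` given their past. -/
noncomputable def blockPredict (μ : Measure Ω) (F₀ : MeasurableSpace Ω) (T : Ω → Ω) (X₀ : Ω → ℝ)
    (p : ℝ) (r l : ℕ) : Ω → ℝ :=
  lpSum p (Finset.range (2 ^ (r - l))) fun c => μ[block T X₀ l c | pastSigma T F₀ (c * 2 ^ l)]

/-- Dominates the errors made by the blocks of length `2^l` in not being adapted. -/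
noncomputable def blockError (μ : Measure Ω) (F₀ : MeasurableSpace Ω) (T : Ω → Ω) (X₀ : Ω → ℝ)
    (p : ℝ) (r l : ℕ) : Ω → ℝ :=
  lpSum p (Finset.range (2 ^ (r - l))) fun c ω =>
    block T X₀ l c ω - (μ[block T X₀ l c | pastSigma T F₀ ((c + 1) * 2 ^ l)]) ω

lemma partialSum_succ_mul (l c : ℕ) :
    partialSum T X₀ ((c + 1) * 2 ^ l) = partialSum T X₀ (c * 2 ^ l) + block T X₀ l c := by
  ext ω
  rw [add_mul, one_mul, partialSum_add]
  rfl

lemma memLp_block {P : ℝ≥0∞} (hT : MeasurePreserving T μ μ) (hX : MemLp X₀ P μ) (l c : ℕ) :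
    MemLp (block T X₀ l c) P μ :=
  memLp_iterate hT (memLp_partialSum hT hX _) _

lemma abs_condExp_le_condMax_of_le {F : ℕ → MeasurableSpace Ω} {W Y : Ω → ℝ} {k n : ℕ}
    (hk : k ≤ n) (hW : Integrable W μ) (hY : Integrable Y μ) (h : ∀ ω, |W ω| ≤ |Y ω|) :
    ∀ᵐ ω ∂μ, |(μ[W | F k]) ω| ≤ condMax μ F Y n ω := by
  filter_upwards [norm_condExp_le (μ := μ) (m := F k) W,
    condExp_mono (m := F k) hW.norm hY.norm (Filter.Eventually.of_forall h)] with ω h1 h2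
  exact (h1.trans (h2.trans (le_abs_self _))).trans (le_condMax hk ω)

lemma memLp_blockPredict (hp : 1 ≤ p) (hT : MeasurePreserving T μ μ)
    (hX : MemLp X₀ (ENNReal.ofReal p) μ) (r l : ℕ) :
    MemLp (blockPredict μ F₀ T X₀ p r l) (ENNReal.ofReal p) μ :=
  memLp_lpSum (by linarith) fun c _ => (memLp_block hT hX l c).condExp (by simpa using hp)

lemma memLp_blockError (hp : 1 ≤ p) (hT : MeasurePreserving T μ μ)
    (hX : MemLp X₀ (ENNReal.ofReal p) μ) (r l : ℕ) :
    MemLp (blockError μ F₀ T X₀ p r l) (ENNReal.ofReal p) μ :=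
  memLp_lpSum (by linarith) fun c _ =>
    (memLp_block hT hX l c).sub ((memLp_block hT hX l c).condExp (by simpa using hp))

variable [IsProbabilityMeasure μ]

lemma lpNorm_blockPredict_le (hp : 1 ≤ p) (hT : MeasurePreserving T μ μ) (hle : F₀ ≤ mΩ)
    (hX : MemLp X₀ (ENNReal.ofReal p) μ) (r l : ℕ) :
    lpNorm (blockPredict μ F₀ T X₀ p r l) (ENNReal.ofReal p) μ ≤
      ((2 : ℝ) ^ (r - l)) ^ (1 / p) *
        lpNorm (μ[partialSum T X₀ (2 ^ l) | F₀]) (ENNReal.ofReal p) μ := by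
  have hp1 : 1 ≤ ENNReal.ofReal p := by simpa using hp
  have := lpNorm_lpSum_le (μ := μ) (s := Finset.range (2 ^ (r - l)))
    (Z := fun c => μ[block T X₀ l c | pastSigma T F₀ (c * 2 ^ l)]) (by linarith : 0 < p)
    (fun c _ => (memLp_block hT hX l c).condExp hp1) lpNorm_nonneg
    (fun c _ => (lpNorm_condExp_shift hT hle ((memLp_partialSum hT hX (2 ^ l)).integrable hp1)
      (c * 2 ^ l)).le)
  simpa [blockPredict] using this

lemma lpNorm_blockError_le (hp : 1 ≤ p) (hT : MeasurePreserving T μ μ) (hle : F₀ ≤ mΩ)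
    (hX : MemLp X₀ (ENNReal.ofReal p) μ) (r l : ℕ) :
    lpNorm (blockError μ F₀ T X₀ p r l) (ENNReal.ofReal p) μ ≤
      ((2 : ℝ) ^ (r - l)) ^ (1 / p) * lpNorm (fun ω => partialSum T X₀ (2 ^ l) ω -
        (μ[partialSum T X₀ (2 ^ l) | pastSigma T F₀ (2 ^ l)]) ω) (ENNReal.ofReal p) μ := by
  have hp1 : 1 ≤ ENNReal.ofReal p := by simpa using hp
  have := lpNorm_lpSum_le (μ := μ) (s := Finset.range (2 ^ (r - l)))
    (Z := fun c ω => block T X₀ l c ω -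
      (μ[block T X₀ l c | pastSigma T F₀ ((c + 1) * 2 ^ l)]) ω) (by linarith : 0 < p)
    (fun c _ => (memLp_block hT hX l c).sub ((memLp_block hT hX l c).condExp hp1)) lpNorm_nonneg
    (fun c _ => by
      have := lpNorm_sub_condExp_shift (P := ENNReal.ofReal p) hT hle
        ((memLp_partialSum hT hX (2 ^ l)).integrable hp1) (2 ^ l) (c * 2 ^ l)
      rw [show 2 ^ l + c * 2 ^ l = (c + 1) * 2 ^ l by ring] at this
      exact this.le)
  simpa [blockError] using this

/-- Dyadic chaining of the conditional expectations of the increments given the past. -/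
lemma exists_abs_condExp_increment_le (hp : 1 ≤ p) (hT : MeasurePreserving T μ μ) (hle : F₀ ≤ mΩ)
    (hF : F₀ ≤ F₀.comap T) (hX : MemLp X₀ (ENNReal.ofReal p) μ) {r m : ℕ} (hm : m ≤ 2 ^ r) (l : ℕ)
    (hl : l ≤ r) : ∃ c, m ≤ c * 2 ^ l ∧ c * 2 ^ l ≤ 2 ^ r ∧
      ∀ᵐ ω ∂μ, |(μ[partialSum T X₀ (c * 2 ^ l) - partialSum T X₀ m | pastSigma T F₀ m]) ω| ≤
        ∑ i ∈ Finset.range l,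
          condMax μ (pastSigma T F₀) (blockPredict μ F₀ T X₀ p r i) (2 ^ r) ω := by
  have hp1 : 1 ≤ ENNReal.ofReal p := by simpa using hp
  have hS : ∀ k, Integrable (partialSum T X₀ k) μ := fun k =>
    (memLp_partialSum hT hX k).integrable hp1
  induction l with
  | zero => exact ⟨m, by simp, by simpa using hm, by simp [condExp_zero]⟩
  | succ l ih =>
    obtain ⟨c, hmc, hcr, hb⟩ := ih (by omega)
    -- If `c` is even, the end point is already a multiple of 2^(l+1). If it is odd, one further
    -- block of length 2^l reaches the next such multiple.
    rcases Nat.even_or_odd' c with ⟨d, rfl | rfl⟩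
    · have he : d * 2 ^ (l + 1) = 2 * d * 2 ^ l := by ring
      refine ⟨d, by rwa [he], by rwa [he], ?_⟩
      rw [he]
      filter_upwards [hb] with ω h
      rw [Finset.sum_range_succ]
      exact h.trans (le_add_of_nonneg_right (condMax_nonneg _ _))
    · have he : (d + 1) * 2 ^ (l + 1) = (2 * d + 1 + 1) * 2 ^ l := by ring
      have hpow : 2 ^ r = 2 ^ (r - l) * 2 ^ l := by rw [← pow_add]; congr 1; omega
      have hc1 : 2 * d + 1 ≤ 2 ^ (r - l) := by
        rw [hpow] at hcr
        exact Nat.le_of_mul_le_mul_right hcr (by positivity)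
      -- Here `l < r`, so 2^(r-l) is even and cannot equal the odd index: the added block still ends
      -- at or before 2^r.
      have hc2 : 2 * d + 1 < 2 ^ (r - l) := by
        have : 2 ^ (r - l) = 2 * 2 ^ (r - l - 1) := by rw [← pow_succ']; congr 1; omega
        omega
      refine ⟨d + 1, ?_, ?_, ?_⟩
      · rw [he]; exact hmc.trans (Nat.mul_le_mul_right _ (by omega))
      · rw [he, hpow]; exact Nat.mul_le_mul_right _ (by omega)
      · rw [he, partialSum_succ_mul, add_sub_right_comm]
        have hB : Integrable (block T X₀ l (2 * d + 1)) μ := (memLp_block hT hX l _).integrable hp1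
        have h1 := condExp_add ((hS ((2 * d + 1) * 2 ^ l)).sub (hS m)) hB (pastSigma T F₀ m)
        -- The block starts after time `m`, so its prediction given F_m is that of its prediction
        -- given its own past.
        have h2 := condExp_condExp_of_le (μ := μ) (f := block T X₀ l (2 * d + 1))
          (pastSigma_mono hF hmc) (pastSigma_le hT hle _)
        have h3 := abs_condExp_le_condMax_of_le (μ := μ) (F := pastSigma T F₀) hm
          (integrable_condExp (μ := μ) (m := pastSigma T F₀ ((2 * d + 1) * 2 ^ l))
            (f := block T X₀ l (2 * d + 1)))
          ((memLp_blockPredict (F₀ := F₀) hp hT hX r l).integrable hp1) (fun ω => by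
            refine le_trans ?_ (le_abs_self _)
            exact abs_le_lpSum (by linarith)
              (Z := fun c => μ[block T X₀ l c | pastSigma T F₀ (c * 2 ^ l)])
              (Finset.mem_range.2 hc2) ω)
        filter_upwards [hb, h1, h2, h3] with ω a1 a2 a3 a4
        rw [a2, Pi.add_apply, Finset.sum_range_succ]
        refine (abs_add_le _ _).trans (add_le_add a1 ?_)
        rwa [← a3]

/-- Dyadic chaining of the errors in not being adapted. -/
lemma exists_abs_sub_condExp_le (hp : 1 ≤ p) (hT : MeasurePreserving T μ μ) (hle : F₀ ≤ mΩ)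
    (hF : F₀ ≤ F₀.comap T) (hX : MemLp X₀ (ENNReal.ofReal p) μ) {r m : ℕ} (hm : m ≤ 2 ^ r) (l : ℕ)
    (hl : l ≤ r + 1) : ∃ c, c * 2 ^ l ≤ m ∧
      ∀ᵐ ω ∂μ, |(partialSum T X₀ m - partialSum T X₀ (c * 2 ^ l)) ω -
          (μ[partialSum T X₀ m - partialSum T X₀ (c * 2 ^ l) | pastSigma T F₀ m]) ω| ≤
        ∑ i ∈ Finset.range l, (blockError μ F₀ T X₀ p r i ω +
          condMax μ (pastSigma T F₀) (blockError μ F₀ T X₀ p r i) (2 ^ r) ω) := by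
  have hp1 : 1 ≤ ENNReal.ofReal p := by simpa using hp
  have hS : ∀ k, Integrable (partialSum T X₀ k) μ := fun k =>
    (memLp_partialSum hT hX k).integrable hp1
  induction l with
  | zero => exact ⟨m, by simp, by simp [condExp_zero]⟩
  | succ l ih =>
    obtain ⟨c, hcm, hb⟩ := ih (by omega)
    -- The chain now descends from `m`: in the odd case the last block of length 2^l before the end
    -- point is split off.
    rcases Nat.even_or_odd' c with ⟨d, rfl | rfl⟩
    · have he : d * 2 ^ (l + 1) = 2 * d * 2 ^ l := by ring
      refine ⟨d, by rwa [he], ?_⟩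
      rw [he]
      filter_upwards [hb] with ω h
      rw [Finset.sum_range_succ]
      exact h.trans (le_add_of_nonneg_right (add_nonneg (lpSum_nonneg _) (condMax_nonneg _ _)))
    · have he : d * 2 ^ (l + 1) = 2 * d * 2 ^ l := by ring
      have hpow : 2 ^ r = 2 ^ (r - l) * 2 ^ l := by rw [← pow_add]; congr 1; omega
      have hc1 : 2 * d < 2 ^ (r - l) := by
        have := hcm.trans hm
        rw [hpow] at this
        exact Nat.le_of_mul_le_mul_right this (by positivity)
      refine ⟨d, ?_, ?_⟩
      · rw [he]; exact (Nat.mul_le_mul_right _ (by omega)).trans hcm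
      · rw [he]
        set B := block T X₀ l (2 * d) with hBdef
        have hB : Integrable B μ := (memLp_block hT hX l _).integrable hp1
        set G := pastSigma T F₀ ((2 * d + 1) * 2 ^ l) with hG
        have hsplit : partialSum T X₀ m - partialSum T X₀ (2 * d * 2 ^ l) =
            (partialSum T X₀ m - partialSum T X₀ ((2 * d + 1) * 2 ^ l)) + B := by
          rw [partialSum_succ_mul]; abel
        rw [hsplit]
        have h1 := condExp_add ((hS m).sub (hS ((2 * d + 1) * 2 ^ l))) hB (pastSigma T F₀ m)
        have hGm : G ≤ pastSigma T F₀ m := pastSigma_mono hF hcm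
        -- The block `B` ends before `m`, so E(B | G) is F_m-measurable. Hence B - E(B | F_m) = D -
        -- E(D | F_m) with D = B - E(B | G), which is dominated by `blockError` plus its running
        -- conditional maximum.
        have h2 : μ[μ[B | G] | pastSigma T F₀ m] = μ[B | G] :=
          condExp_of_stronglyMeasurable (pastSigma_le hT hle _)
            (stronglyMeasurable_condExp.mono hGm) integrable_condExp
        have h3 := condExp_sub hB (integrable_condExp (μ := μ) (m := G) (f := B))
          (pastSigma T F₀ m)
        have hbd : ∀ ω, |(B - μ[B | G]) ω| ≤ blockError μ F₀ T X₀ p r l ω := fun ω =>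
          abs_le_lpSum (by linarith) (Z := fun c ω => block T X₀ l c ω -
            (μ[block T X₀ l c | pastSigma T F₀ ((c + 1) * 2 ^ l)]) ω)
            (Finset.mem_range.2 hc1) ω
        have h4 := abs_condExp_le_condMax_of_le (μ := μ) (F := pastSigma T F₀) hm
          (hB.sub (integrable_condExp (μ := μ) (m := G) (f := B)))
          ((memLp_blockError (F₀ := F₀) hp hT hX r l).integrable hp1) (fun ω =>
            (hbd ω).trans (le_abs_self _))
        rw [h2] at h3
        filter_upwards [hb, h1, h3, h4] with ω a1 a2 a3 a4
        rw [a2, Finset.sum_range_succ]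
        have h5 := hbd ω
        simp only [Pi.add_apply, Pi.sub_apply] at *
        rw [a3] at a4
        have e : ∀ x y z w v : ℝ, x + y - (z + w) = (x - z) + ((y - v) - (w - v)) := by
          intros; ring
        rw [e _ _ _ _ ((μ[B | G]) ω)]
        refine (abs_add_le _ _).trans (add_le_add a1 ?_)
        exact (abs_sub _ _).trans (add_le_add h5 a4)

end Maximal

section Maximal

variable {Ω : Type*} {F₀ mΩ : MeasurableSpace Ω} {μ : Measure Ω} {T : Ω → Ω} {X₀ : Ω → ℝ} {p : ℝ}
  [IsProbabilityMeasure μ]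

/-- A random variable dominating `|S_m|` for all `1 ≤ m ≤ 2^r`. -/
noncomputable def maxBound (μ : Measure Ω) (F₀ : MeasurableSpace Ω) (T : Ω → Ω) (X₀ : Ω → ℝ)
    (p : ℝ) (r : ℕ) : Ω → ℝ :=
  condMax μ (pastSigma T F₀) (partialSum T X₀ (2 ^ r)) (2 ^ r) +
    ∑ i ∈ Finset.range r, condMax μ (pastSigma T F₀) (blockPredict μ F₀ T X₀ p r i) (2 ^ r) +
    ∑ i ∈ Finset.range (r + 1), (blockError μ F₀ T X₀ p r i +
      condMax μ (pastSigma T F₀) (blockError μ F₀ T X₀ p r i) (2 ^ r))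

lemma abs_partialSum_le_maxBound (hp : 1 ≤ p) (hT : MeasurePreserving T μ μ) (hle : F₀ ≤ mΩ)
    (hF : F₀ ≤ F₀.comap T) (hX : MemLp X₀ (ENNReal.ofReal p) μ) {r m : ℕ} (hm1 : 1 ≤ m)
    (hm : m ≤ 2 ^ r) : ∀ᵐ ω ∂μ, |partialSum T X₀ m ω| ≤ maxBound μ F₀ T X₀ p r ω := by
  have hp1 : 1 ≤ ENNReal.ofReal p := by simpa using hp
  have hS : ∀ k, Integrable (partialSum T X₀ k) μ := fun k =>
    (memLp_partialSum hT hX k).integrable hp1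
  obtain ⟨c, hmc, hcr, hb⟩ := exists_abs_condExp_increment_le hp hT hle hF hX hm r le_rfl
  -- The ascending chain ends exactly at 2^r: `1 ≤ m` excludes `c = 0`.
  have hc : c = 1 := by
    have h1 : c * 2 ^ r ≤ 1 * 2 ^ r := by simpa using hcr
    have := Nat.le_of_mul_le_mul_right h1 (by positivity)
    have : c ≠ 0 := by rintro rfl; omega
    omega
  obtain ⟨d, hdm, hd⟩ := exists_abs_sub_condExp_le hp hT hle hF hX hm (r + 1) le_rfl
  -- The descending chain needs one more level, r + 1, because `m` may equal 2^r; then 2^(r+1) > m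
  -- forces it to reach 0.
  have hd0 : d = 0 := by
    by_contra h
    have h1 : 1 * 2 ^ (r + 1) ≤ d * 2 ^ (r + 1) := Nat.mul_le_mul_right _ (by omega)
    have : (2 : ℕ) ^ (r + 1) = 2 * 2 ^ r := by ring
    have : 0 < (2 : ℕ) ^ r := by positivity
    omega
  subst hc hd0
  rw [one_mul] at hb
  have h0 : partialSum T X₀ (0 * 2 ^ (r + 1)) = 0 := by ext ω; simp [partialSum]
  rw [h0, sub_zero] at hd
  have h1 := abs_condExp_le_condMax (μ := μ) (F := pastSigma T F₀) (Z := partialSum T X₀ (2 ^ r)) hm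
  have h2 := condExp_sub (hS (2 ^ r)) (hS m) (pastSigma T F₀ m)
  filter_upwards [hb, hd, h1, h2] with ω a1 a2 a3 a4
  rw [a4, Pi.sub_apply] at a1
  simp only [maxBound, Pi.add_apply, Finset.sum_apply]
  set x := (μ[partialSum T X₀ (2 ^ r) | pastSigma T F₀ m]) ω
  set y := (μ[partialSum T X₀ m | pastSigma T F₀ m]) ω
  set s := partialSum T X₀ m ω
  calc |s| = |x - (x - y) + (s - y)| := by congr 1; ring
    _ ≤ |x| + |x - y| + |s - y| := (abs_add_le _ _).trans (by gcongr; exact abs_sub _ _)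
    _ ≤ _ := add_le_add (add_le_add a3 a1) a2

/-- The factor 2 is Doob's constant. The factor 3 is 1 + 2, since each block error enters both
directly and through its running conditional maximum. -/
lemma lpNorm_maxAbsPartialSum_le (hp : 2 ≤ p) (hT : MeasurePreserving T μ μ) (hle : F₀ ≤ mΩ)
    (hF : F₀ ≤ F₀.comap T) (hX : MemLp X₀ (ENNReal.ofReal p) μ) {r n : ℕ} (hn : 1 ≤ n)
    (hnr : n ≤ 2 ^ r) :
    lpNorm (maxAbsPartialSum T X₀ n hn) (ENNReal.ofReal p) μ ≤
      2 * lpNorm (partialSum T X₀ (2 ^ r)) (ENNReal.ofReal p) μ +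
      ∑ l ∈ Finset.range r, 2 * (((2 : ℝ) ^ (r - l)) ^ (1 / p) *
        lpNorm (μ[partialSum T X₀ (2 ^ l) | F₀]) (ENNReal.ofReal p) μ) +
      ∑ l ∈ Finset.range (r + 1), 3 * (((2 : ℝ) ^ (r - l)) ^ (1 / p) *
        lpNorm (fun ω => partialSum T X₀ (2 ^ l) ω -
          (μ[partialSum T X₀ (2 ^ l) | pastSigma T F₀ (2 ^ l)]) ω) (ENNReal.ofReal p) μ) := by
  have hp' : 1 ≤ p := by linarith
  have hp1 : 1 ≤ ENNReal.ofReal p := by simpa using hp'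
  have hmono := pastSigma_mono hF
  have hles := pastSigma_le hT hle
  have hSN := memLp_partialSum hT hX (2 ^ r)
  have hP := memLp_blockPredict (F₀ := F₀) hp' hT hX r
  have hE := memLp_blockError (F₀ := F₀) hp' hT hX r
  have m1 : MemLp (condMax μ (pastSigma T F₀) (partialSum T X₀ (2 ^ r)) (2 ^ r))
    (ENNReal.ofReal p) μ := memLp_condMax hp1 hSN _
  have m2 : ∀ i ∈ Finset.range r, MemLp (condMax μ (pastSigma T F₀)
    (blockPredict μ F₀ T X₀ p r i) (2 ^ r)) (ENNReal.ofReal p) μ :=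
      fun i _ => memLp_condMax hp1 (hP i) _
  have m3 : ∀ i ∈ Finset.range (r + 1), MemLp (blockError μ F₀ T X₀ p r i +
      condMax μ (pastSigma T F₀) (blockError μ F₀ T X₀ p r i) (2 ^ r)) (ENNReal.ofReal p) μ :=
      fun i _ => (hE i).add (memLp_condMax hp1 (hE i) _)
  have hG : MemLp (maxBound μ F₀ T X₀ p r) (ENNReal.ofReal p) μ :=
    (m1.add (memLp_finsetSum' _ m2)).add (memLp_finsetSum' _ m3)
  have hdom : ∀ᵐ ω ∂μ, |maxAbsPartialSum T X₀ n hn ω| ≤ maxBound μ F₀ T X₀ p r ω := by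
    have : ∀ m ∈ Finset.Icc 1 n, ∀ᵐ ω ∂μ, |partialSum T X₀ m ω| ≤ maxBound μ F₀ T X₀ p r ω :=
      fun m hm => abs_partialSum_le_maxBound hp' hT hle hF hX (Finset.mem_Icc.1 hm).1
        ((Finset.mem_Icc.1 hm).2.trans hnr)
    filter_upwards [(Finset.eventually_all _).2 this] with ω h
    rw [abs_of_nonneg]
    · exact Finset.sup'_le _ _ h
    · exact (abs_nonneg _).trans
        (Finset.le_sup' (fun j => |partialSum T X₀ j ω|) (Finset.mem_Icc.2 ⟨le_rfl, hn⟩))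
  refine (lpNorm_mono_ae hG hdom).trans ?_
  refine (lpNorm_add_le (m1.add (memLp_finsetSum' _ m2)) hp1).trans ?_
  refine add_le_add ((lpNorm_add_le m1 hp1).trans (add_le_add ?_ ?_)) ?_
  · exact lpNorm_condMax_le hmono hles hp hSN _
  · refine (lpNorm_sum_le m2 hp1).trans (Finset.sum_le_sum fun i _ => ?_)
    exact (lpNorm_condMax_le hmono hles hp (hP i) _).trans
      (mul_le_mul_of_nonneg_left (lpNorm_blockPredict_le hp' hT hle hX r i) zero_le_two)
  · refine (lpNorm_sum_le m3 hp1).trans (Finset.sum_le_sum fun i _ => ?_)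
    have h1 := lpNorm_condMax_le hmono hles hp (hE i) (2 ^ r)
    have h2 := lpNorm_blockError_le hp' hT hle hX r i
    have h3 := lpNorm_add_le (g := condMax μ (pastSigma T F₀) (blockError μ F₀ T X₀ p r i) (2 ^ r))
      (hE i) hp1
    linarith

end Maximal

/-! ### Pointwise expansion of |x + y|^p. -/

section Elementary

/-- Convexity: the tangent to x^q at `s` lies below the curve at x = 1. It is Bernoulli's inequality
for `s⁻¹`, multiplied by s^q. -/
lemma rpow_le_one_add_tangent {s q : ℝ} (hs : 0 ≤ s) (hq : 1 < q) :
    s ^ q ≤ 1 + q * s ^ (q - 1) * (s - 1) := by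
  rcases hs.eq_or_lt with rfl | hs
  · rw [Real.zero_rpow (by linarith), Real.zero_rpow (by linarith)]; norm_num
  · have hb := one_add_mul_self_le_rpow_one_add (s := s⁻¹ - 1) (p := q)
      (by have := inv_pos.2 hs; linarith) hq.le
    rw [add_sub_cancel, Real.inv_rpow hs.le] at hb
    have hpos : 0 < s ^ q := Real.rpow_pos_of_pos hs q
    have h := mul_le_mul_of_nonneg_left hb hpos.le
    rw [mul_inv_cancel₀ hpos.ne'] at h
    have h1 : s ^ q = s ^ (q - 1) * s := by
      rw [← Real.rpow_add_one hs.ne']; congr 1; ring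
    have h2 : s ^ q * s⁻¹ = s ^ (q - 1) := by rw [h1, mul_assoc, mul_inv_cancel₀ hs.ne', mul_one]
    nlinarith

/-- The tangent inequality leaves ((1 + t)^{p-1} - 1) t to be compared with t². For t ≥ 0 this is
the tangent inequality with exponent p - 1, for t ≤ 0 Bernoulli's inequality. -/
lemma rpow_one_add_le_taylor {p t : ℝ} (hp : 2 < p) (ht1 : -1 ≤ t) (ht2 : t ≤ 1) :
    (1 + t) ^ p ≤ 1 + p * t + p * ((p - 1) * 2 ^ (p - 2)) * t ^ 2 := by
  have hs : 0 ≤ 1 + t := by linarith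
  have h1 := rpow_le_one_add_tangent hs (by linarith : 1 < p)
  rw [add_sub_cancel_left] at h1
  have h2p : (1 : ℝ) ≤ 2 ^ (p - 2) := Real.one_le_rpow one_le_two (by linarith)
  have key : ((1 + t) ^ (p - 1) - 1) * t ≤ (p - 1) * 2 ^ (p - 2) * t ^ 2 := by
    rcases le_total 0 t with h | h
    · have h2 := rpow_le_one_add_tangent hs (by linarith : 1 < p - 1)
      rw [add_sub_cancel_left, show p - 1 - 1 = p - 2 by ring] at h2
      have h3 : (1 + t) ^ (p - 2) ≤ 2 ^ (p - 2) :=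
        Real.rpow_le_rpow hs (by linarith) (by linarith)
      have h4 : (p - 1) * (1 + t) ^ (p - 2) * t ≤ (p - 1) * 2 ^ (p - 2) * t :=
        mul_le_mul_of_nonneg_right (mul_le_mul_of_nonneg_left h3 (by linarith)) h
      calc ((1 + t) ^ (p - 1) - 1) * t ≤ ((p - 1) * 2 ^ (p - 2) * t) * t :=
            mul_le_mul_of_nonneg_right (by linarith) h
        _ = _ := by ring
    · have h2 := one_add_mul_self_le_rpow_one_add ht1 (by linarith : 1 ≤ p - 1)
      calc ((1 + t) ^ (p - 1) - 1) * t ≤ ((p - 1) * t) * t :=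
            mul_le_mul_of_nonpos_right (by linarith) h
        _ = (p - 1) * 1 * t ^ 2 := by ring
        _ ≤ _ := mul_le_mul_of_nonneg_right
            (mul_le_mul_of_nonneg_left h2p (by linarith)) (sq_nonneg t)
  have h5 := mul_le_mul_of_nonneg_left key (by linarith : 0 ≤ p)
  linarith [h1, h5]

/-- The weight `w` is large enough to absorb the moment of order `p - 1` with the help of a
fraction `ε` of the moment of order `p`. -/
def Absorbs (p ε w : ℝ) : Prop :=
  0 ≤ ε ∧ 1 ≤ w ∧ (p ≤ 3 ∨ (0 < ε ∧ ε ^ (-(p - 3)) ≤ w))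

/-- The constant of the second order term in `abs_add_rpow_le`. -/
noncomputable def taylorConst (p : ℝ) : ℝ :=
  p * ((p - 1) * 2 ^ (p - 2)) + p + p * 2 ^ (p - 1) + p * 2 ^ (p - 1) * (p * 2 ^ (p - 1)) ^ (p - 3)

lemma taylorConst_nonneg {p : ℝ} (hp : 2 < p) : 0 ≤ taylorConst p := by
  have : 0 < p := by linarith
  have : 0 < p - 1 := by linarith
  unfold taylorConst; positivity

/-- For |t| ≤ 1 this is the second order expansion. For |t| ≥ 1 the excess over |t|^p is at most c
|t|^{p-1}, which is below c t² when p ≤ 3 and otherwise must be shared between ε |t|^p and w t². -/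
lemma abs_one_add_rpow_le {p ε w t : ℝ} (hp : 2 < p) (h : Absorbs p ε w) :
    |1 + t| ^ p ≤ 1 + (1 + ε) * |t| ^ p + p * t + taylorConst p * w * t ^ 2 := by
  obtain ⟨hε, hw, hεw⟩ := h
  have hp0 : 0 < p := by linarith
  have hp1 : 0 < p - 1 := by linarith
  set c : ℝ := p * 2 ^ (p - 1) with hc
  set c₁ : ℝ := p * ((p - 1) * 2 ^ (p - 2)) with hc1
  have hc0 : 0 < c := by positivity
  have hc10 : 0 ≤ c₁ := by positivity
  have hC : taylorConst p = c₁ + p + c + c * c ^ (p - 3) := rfl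
  have hcc : 0 ≤ c * c ^ (p - 3) := by positivity
  have ht2 : 0 ≤ t ^ 2 := sq_nonneg t
  have htw : t ^ 2 ≤ w * t ^ 2 := le_mul_of_one_le_left ht2 hw
  rcases le_total |t| 1 with ht | ht
  · obtain ⟨h1, h2⟩ := abs_le.1 ht
    have hT := rpow_one_add_le_taylor hp h1 h2
    rw [abs_of_nonneg (by linarith : 0 ≤ 1 + t)]
    have h3 : 0 ≤ (1 + ε) * |t| ^ p := by positivity
    have h4 : c₁ * t ^ 2 ≤ taylorConst p * (w * t ^ 2) := by
      rw [hC]; gcongr; linarith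
    linarith
  · set a := |t| with ha
    have ha0 : 0 < a := by linarith
    have hat : t ^ 2 = a ^ 2 := (sq_abs t).symm
    have h1 : |1 + t| ^ p ≤ a ^ p + c * a ^ (p - 1) := by
      have h2 : |1 + t| ≤ a * (1 + a⁻¹) := by
        rw [mul_add, mul_inv_cancel₀ ha0.ne', mul_one]
        have := abs_add_le 1 t
        rw [abs_one] at this
        linarith
      have hai : a⁻¹ ≤ 1 := inv_le_one_of_one_le₀ ht
      have hai0 : 0 < a⁻¹ := inv_pos.2 ha0
      have h3 := rpow_le_one_add_tangent (by linarith : 0 ≤ 1 + a⁻¹) (by linarith : 1 < p)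
      have h4 : (1 + a⁻¹) ^ (p - 1) ≤ 2 ^ (p - 1) :=
        Real.rpow_le_rpow (by linarith) (by linarith) hp1.le
      have h5 : (1 + a⁻¹) ^ p ≤ 1 + c * a⁻¹ := by
        rw [add_sub_cancel_left] at h3
        refine h3.trans ?_
        rw [hc]; gcongr
      have h6 : a ^ p * a⁻¹ = a ^ (p - 1) := by
        rw [Real.rpow_sub_one ha0.ne', div_eq_mul_inv]
      calc |1 + t| ^ p ≤ (a * (1 + a⁻¹)) ^ p := Real.rpow_le_rpow (abs_nonneg _) h2 hp0.le
        _ = a ^ p * (1 + a⁻¹) ^ p := Real.mul_rpow ha0.le (by positivity)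
        _ ≤ a ^ p * (1 + c * a⁻¹) := by gcongr
        _ = a ^ p + c * a ^ (p - 1) := by rw [← h6]; ring
    have h7 : a ^ (p - 1) = a ^ (p - 3) * a ^ 2 := by
      rw [← Real.rpow_natCast a 2, ← Real.rpow_add ha0]; congr 1; push_cast; ring
    have h8 : c * a ^ (p - 1) ≤ ε * a ^ p + (c + c * c ^ (p - 3)) * (w * a ^ 2) := by
      have hap : 0 ≤ ε * a ^ p := by positivity
      have hwa : a ^ 2 ≤ w * a ^ 2 := le_mul_of_one_le_left (by positivity) hw
      rcases hεw with h3 | ⟨hε0, hεw⟩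
      · have : a ^ (p - 3) ≤ 1 := Real.rpow_le_one_of_one_le_of_nonpos ht (by linarith)
        have h9 : a ^ (p - 3) * a ^ 2 ≤ w * a ^ 2 :=
          (mul_le_of_le_one_left (by positivity) this).trans hwa
        have h10 : c * a ^ (p - 1) ≤ c * (w * a ^ 2) := by rw [h7]; gcongr
        have h11 : 0 ≤ c * c ^ (p - 3) * (w * a ^ 2) := by positivity
        linarith
      · rcases le_total p 3 with h3 | h3
        · have : a ^ (p - 3) ≤ 1 := Real.rpow_le_one_of_one_le_of_nonpos ht (by linarith)
          have h9 : a ^ (p - 3) * a ^ 2 ≤ w * a ^ 2 :=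
            (mul_le_of_le_one_left (by positivity) this).trans hwa
          have h10 : c * a ^ (p - 1) ≤ c * (w * a ^ 2) := by rw [h7]; gcongr
          have h11 : 0 ≤ c * c ^ (p - 3) * (w * a ^ 2) := by positivity
          linarith
        -- Either `a` is so large that c a^{p-1} ≤ ε a^p, or a ≤ c/ε and a^{p-3} is at most c^{p-3}
        -- ε^{-(p-3)} ≤ c^{p-3} w.
        rcases le_total c (ε * a) with h | h
        · have h9 : c * a ^ (p - 1) ≤ ε * a * a ^ (p - 1) := by gcongr
          have h10 : a * a ^ (p - 1) = a ^ p := by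
            rw [mul_comm, ← Real.rpow_add_one ha0.ne']; congr 1; ring
          rw [mul_assoc ε, h10] at h9
          have h11 : 0 ≤ (c + c * c ^ (p - 3)) * (w * a ^ 2) := by positivity
          linarith
        · have h9 : a ≤ c * ε⁻¹ := by
            rw [← div_eq_mul_inv, le_div_iff₀ hε0]; linarith
          have h10 : a ^ (p - 3) ≤ c ^ (p - 3) * w := by
            refine (Real.rpow_le_rpow ha0.le h9 (by linarith)).trans ?_
            rw [Real.mul_rpow hc0.le (by positivity), Real.inv_rpow hε, ← Real.rpow_neg hε]
            gcongr
          have h11 : c * a ^ (p - 1) ≤ c * (c ^ (p - 3) * w * a ^ 2) := by rw [h7]; gcongr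
          have h12 : 0 ≤ c * (w * a ^ 2) := by positivity
          linarith
    -- The linear term is negative for t < 0; the summand `p` of `taylorConst` compensates for it.
    have h13 : -(p * (w * a ^ 2)) ≤ p * t := by
      have : -a ≤ t := neg_abs_le t
      have h14 : a ≤ a ^ 2 := by nlinarith
      have h15 : -(w * a ^ 2) ≤ t := by rw [hat] at htw; linarith
      nlinarith
    have h16 : 0 ≤ c₁ * (w * a ^ 2) := by positivity
    rw [hC, hat]
    linarith

lemma abs_add_rpow_le {p ε w : ℝ} (hp : 2 < p) (h : Absorbs p ε w) (x y : ℝ) :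
    |x + y| ^ p ≤ |x| ^ p + (1 + ε) * |y| ^ p + p * (x * |x| ^ (p - 2) * y) +
      taylorConst p * w * (|x| ^ (p - 2) * y ^ 2) := by
  rcases eq_or_ne x 0 with rfl | hx
  · rw [abs_zero, Real.zero_rpow (by linarith), Real.zero_rpow (by linarith)]
    have := mul_nonneg h.1 (Real.rpow_nonneg (abs_nonneg y) p)
    simp only [zero_add, zero_mul, mul_zero, add_zero]
    linarith
  · have hx0 : 0 < |x| := abs_pos.2 hx
    have h1 := abs_one_add_rpow_le (t := y / x) hp h
    have h2 := mul_le_mul_of_nonneg_left h1 (Real.rpow_nonneg hx0.le p)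
    have h3 : |x| ^ p * |1 + y / x| ^ p = |x + y| ^ p := by
      rw [← Real.mul_rpow hx0.le (abs_nonneg _), ← abs_mul]
      congr 2; field_simp
    have h4 : |x| ^ p * |y / x| ^ p = |y| ^ p := by
      rw [← Real.mul_rpow hx0.le (abs_nonneg _), ← abs_mul]
      congr 2; field_simp
    have h5 : |x| ^ p = |x| ^ (p - 2) * x ^ 2 := by
      rw [← sq_abs x, ← Real.rpow_natCast |x| 2, ← Real.rpow_add hx0]; congr 1; push_cast; ring
    rw [h3] at h2
    refine h2.trans (le_of_eq ?_)
    have h6 : |x| ^ p * (y / x) = x * |x| ^ (p - 2) * y := by rw [h5]; field_simp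
    have h7 : |x| ^ p * (y / x) ^ 2 = |x| ^ (p - 2) * y ^ 2 := by rw [h5]; field_simp
    rw [← h6, ← h7, ← h4]
    ring

end Elementary

/-! ### Moments of S_{2k} in terms of S_k. -/

section Products

variable {Ω : Type*} {mΩ : MeasurableSpace Ω} {μ : Measure Ω} {p : ℝ}

lemma holderTriple_half (hp : 0 < p) :
    ENNReal.HolderTriple (ENNReal.ofReal p) (ENNReal.ofReal p) (ENNReal.ofReal (p / 2)) := by
  constructor
  rw [← ENNReal.ofReal_inv_of_pos hp, ← ENNReal.ofReal_inv_of_pos (half_pos hp),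
    ← ENNReal.ofReal_add (by positivity) (by positivity)]
  congr 1
  field_simp
  norm_num

lemma memLp_mul_half {f g : Ω → ℝ} (hp : 0 < p) (hf : MemLp f (ENNReal.ofReal p) μ)
    (hg : MemLp g (ENNReal.ofReal p) μ) :
    MemLp (fun ω => f ω * g ω) (ENNReal.ofReal (p / 2)) μ := by
  have := holderTriple_half hp
  exact hg.mul hf

lemma lpNorm_mul_half_le {f g : Ω → ℝ} (hp : 0 < p) (hf : MemLp f (ENNReal.ofReal p) μ)
    (hg : MemLp g (ENNReal.ofReal p) μ) :
    lpNorm (fun ω => f ω * g ω) (ENNReal.ofReal (p / 2)) μ ≤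
      lpNorm f (ENNReal.ofReal p) μ * lpNorm g (ENNReal.ofReal p) μ := by
  have := holderTriple_half hp
  have h := eLpNorm_smul_le_mul_eLpNorm (p := ENNReal.ofReal p) (q := ENNReal.ofReal p)
    (r := ENNReal.ofReal (p / 2)) hg.1 hf.1
  rw [smul_eq_mul] at h
  rw [← toReal_eLpNorm hf.1, ← toReal_eLpNorm hg.1, ← toReal_eLpNorm (memLp_mul_half hp hf hg).1,
    ← ENNReal.toReal_mul]
  exact ENNReal.toReal_mono (ENNReal.mul_ne_top hf.2.ne hg.2.ne) h

end Products

section Recurrence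

variable {Ω : Type*} {F₀ mΩ : MeasurableSpace Ω} {μ : Measure Ω} {p : ℝ} [IsProbabilityMeasure μ]

/-- The coefficients of V and V² in the pointwise expansion are functions of `U`, hence
`m`-measurable, so V and V² may be conditioned on `m` before Hölder's inequality is applied. -/
lemma lpNorm_add_rpow_le {m mΩ : MeasurableSpace Ω} {μ : Measure Ω} [IsProbabilityMeasure μ]
    {U V : Ω → ℝ} {ε w : ℝ} (hp : 2 < p) (h : Absorbs p ε w)
    (hm : m ≤ mΩ) (hUm : StronglyMeasurable[m] U) (hU : MemLp U (ENNReal.ofReal p) μ)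
    (hV : MemLp V (ENNReal.ofReal p) μ) :
    lpNorm (U + V) (ENNReal.ofReal p) μ ^ p ≤ lpNorm U (ENNReal.ofReal p) μ ^ p +
      (1 + ε) * lpNorm V (ENNReal.ofReal p) μ ^ p +
      p * (lpNorm U (ENNReal.ofReal p) μ ^ (p - 1) * lpNorm (μ[V | m]) (ENNReal.ofReal p) μ) +
      taylorConst p * w * (lpNorm U (ENNReal.ofReal p) μ ^ (p - 2) *
        lpNorm (μ[fun ω => V ω ^ 2 | m]) (ENNReal.ofReal (p / 2)) μ) := by
  have hp0 : 0 < p := by linarith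
  have hp1 : 1 ≤ ENNReal.ofReal p := by simpa using (by linarith : 1 ≤ p)
  have hp2 : 1 ≤ ENNReal.ofReal (p / 2) := by simpa using (by linarith : 1 ≤ p / 2)
  have hV2 : MemLp (fun ω => V ω ^ 2) (ENNReal.ofReal (p / 2)) μ := by
    simpa only [sq] using memLp_mul_half hp0 hV hV
  have habs : ∀ ω, |U ω * |U ω| ^ (p - 2)| = |U ω| ^ (p - 1) := fun ω => by
    rw [abs_mul, abs_of_nonneg (Real.rpow_nonneg (abs_nonneg _) _), mul_comm,
      ← Real.rpow_add_one' (abs_nonneg _) (by linarith)]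
    congr 1; ring
  have hUm2 : StronglyMeasurable[m] fun ω => |U ω| ^ (p - 2) :=
    ((Real.continuous_rpow_const (by linarith)).comp continuous_abs).comp_stronglyMeasurable hUm
  have hUm1 : StronglyMeasurable[m] fun ω => U ω * |U ω| ^ (p - 2) := hUm.mul hUm2
  have hW1 : AEStronglyMeasurable (fun ω => U ω * |U ω| ^ (p - 2)) μ :=
    (hUm1.mono hm).aestronglyMeasurable
  -- linear term
  have hi1 : ∀ B : Ω → ℝ, MemLp B (ENNReal.ofReal p) μ →
      Integrable (fun ω => U ω * |U ω| ^ (p - 2) * B ω) μ ∧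
      ∫ ω, U ω * |U ω| ^ (p - 2) * B ω ∂μ ≤
        lpNorm U (ENNReal.ofReal p) μ ^ (p - 1) * lpNorm B (ENNReal.ofReal p) μ := by
    intro B hB
    obtain ⟨h1, h2⟩ := integral_rpow_mul_le (s := 1) one_pos (by linarith) hU
      (by simpa using hB)
    rw [div_one] at h2
    have h3 : Integrable (fun ω => U ω * |U ω| ^ (p - 2) * B ω) μ :=
      h1.mono (hW1.mul hB.1) (Filter.Eventually.of_forall fun ω => by
        rw [Real.norm_eq_abs, abs_mul, habs]
        exact le_abs_self _)
    refine ⟨h3, le_trans (integral_mono h3 h1 fun ω => ?_) h2⟩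
    dsimp only
    rw [← habs, ← abs_mul]
    exact le_abs_self _
  have hi2 : ∀ B : Ω → ℝ, MemLp B (ENNReal.ofReal (p / 2)) μ →
      Integrable (fun ω => |U ω| ^ (p - 2) * B ω) μ ∧
      ∫ ω, |U ω| ^ (p - 2) * B ω ∂μ ≤
        lpNorm U (ENNReal.ofReal p) μ ^ (p - 2) * lpNorm B (ENNReal.ofReal (p / 2)) μ := by
    intro B hB
    obtain ⟨h1, h2⟩ := integral_rpow_mul_le (s := 2) two_pos hp hU hB
    have h3 : Integrable (fun ω => |U ω| ^ (p - 2) * B ω) μ :=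
      h1.mono ((hUm2.mono hm).aestronglyMeasurable.mul hB.1)
        (Filter.Eventually.of_forall fun ω => by
          rw [Real.norm_eq_abs, abs_mul, abs_of_nonneg (Real.rpow_nonneg (abs_nonneg _) _)]
          exact le_abs_self _)
    refine ⟨h3, le_trans (integral_mono h3 h1 fun ω => ?_) h2⟩
    exact mul_le_mul_of_nonneg_left (le_abs_self _) (Real.rpow_nonneg (abs_nonneg _) _)
  have hl := (hi1 _ (hV.condExp (m := m) hp1)).2
  rw [integral_mul_condExp hm hUm1 (hi1 V hV).1 (hV.integrable hp1)] at hl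
  have hq := (hi2 _ (hV2.condExp (m := m) hp2)).2
  rw [integral_mul_condExp hm hUm2 (hi2 _ hV2).1 (hV2.integrable hp2)] at hq
  have iU := integrable_abs_rpow hp0 hU
  have iV := (integrable_abs_rpow hp0 hV).const_mul (1 + ε)
  have i1 := (hi1 V hV).1.const_mul p
  have i2 := (hi2 _ hV2).1.const_mul (taylorConst p * w)
  have hmain := integral_mono (integrable_abs_rpow hp0 (hU.add hV)) (((iU.add iV).add i1).add i2)
    (fun ω => abs_add_rpow_le hp h (U ω) (V ω))
  rw [integral_add' ((iU.add iV).add i1) i2, integral_add' (iU.add iV) i1, integral_add' iU iV,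
    integral_const_mul, integral_const_mul, integral_const_mul,
    integral_abs_rpow_eq hp0 (hU.add hV).1, integral_abs_rpow_eq hp0 hU.1,
    integral_abs_rpow_eq hp0 hV.1] at hmain
  refine hmain.trans ?_
  gcongr
  exact mul_nonneg (taylorConst_nonneg hp) (by linarith [h.2.1])

/-- The moment of `S_{2k}` in terms of the moment of `S_k`. -/
lemma lpNorm_partialSum_double_le {T : Ω → Ω} {X₀ : Ω → ℝ} {ε w : ℝ} (hp : 2 < p)
    (h : Absorbs p ε w) (hT : MeasurePreserving T μ μ) (hle : F₀ ≤ mΩ)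
    (hX : MemLp X₀ (ENNReal.ofReal p) μ) (k : ℕ) :
    lpNorm (partialSum T X₀ (k + k)) (ENNReal.ofReal p) μ ≤
      ((2 + ε) * lpNorm (partialSum T X₀ k) (ENNReal.ofReal p) μ ^ p +
        p * (lpNorm (partialSum T X₀ k) (ENNReal.ofReal p) μ ^ (p - 1) *
          lpNorm (μ[partialSum T X₀ k | F₀]) (ENNReal.ofReal p) μ) +
        taylorConst p * w * (lpNorm (partialSum T X₀ k) (ENNReal.ofReal p) μ ^ (p - 2) *
          lpNorm (μ[fun ω => partialSum T X₀ k ω ^ 2 | F₀]) (ENNReal.ofReal (p / 2)) μ))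
        ^ (1 / p) +
      lpNorm (fun ω => partialSum T X₀ k ω - (μ[partialSum T X₀ k | pastSigma T F₀ k]) ω)
        (ENNReal.ofReal p) μ := by
  have hp0 : 0 < p := by linarith
  have hp1 : 1 ≤ ENNReal.ofReal p := by simpa using (by linarith : 1 ≤ p)
  have hp2 : 1 ≤ ENNReal.ofReal (p / 2) := by simpa using (by linarith : 1 ≤ p / 2)
  set S := partialSum T X₀ k with hSdef
  have hS : MemLp S (ENNReal.ofReal p) μ := memLp_partialSum hT hX k
  have hS2 : MemLp (fun ω => S ω ^ 2) (ENNReal.ofReal (p / 2)) μ := by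
    simpa only [sq] using memLp_mul_half hp0 hS hS
  -- S_k itself need not be F_k-measurable. It is replaced by its projection `U`, and S_k - U is
  -- kept outside the p-th power by Minkowski's inequality.
  set U := μ[S | pastSigma T F₀ k] with hUdef
  set V : Ω → ℝ := fun ω => S (T^[k] ω) with hVdef
  have hU : MemLp U (ENNReal.ofReal p) μ := hS.condExp hp1
  have hV : MemLp V (ENNReal.ofReal p) μ := memLp_iterate hT hS k
  have hUS : lpNorm U (ENNReal.ofReal p) μ ≤ lpNorm S (ENNReal.ofReal p) μ :=
    hS.lpNorm_condExp_le_lpNorm hp1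
  have hVS : lpNorm V (ENNReal.ofReal p) μ = lpNorm S (ENNReal.ofReal p) μ :=
    lpNorm_comp_measurePreserving (hT.iterate k) hS.1
  have h1 := lpNorm_add_rpow_le hp h (pastSigma_le hT hle k) stronglyMeasurable_condExp hU hV
  rw [hVS, lpNorm_condExp_shift hT hle (hS.integrable hp1) k,
    lpNorm_condExp_shift hT hle (f := fun ω => S ω ^ 2) (hS2.integrable hp2) k] at h1
  have hsplit : partialSum T X₀ (k + k) = (U + V) + fun ω => S ω - U ω := by
    ext ω
    rw [partialSum_add]
    simp only [Pi.add_apply, hVdef, ← hSdef]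
    ring
  rw [hsplit]
  refine (lpNorm_add_le (hU.add hV) hp1).trans (add_le_add_left ?_ _)
  have hε := h.1
  have hw := zero_le_one.trans h.2.1
  have hC0 := taylorConst_nonneg hp
  have n1 : 0 ≤ lpNorm S (ENNReal.ofReal p) μ := lpNorm_nonneg
  have n2 : 0 ≤ lpNorm (μ[S | F₀]) (ENNReal.ofReal p) μ := lpNorm_nonneg
  have n3 : 0 ≤ lpNorm (μ[fun ω => S ω ^ 2 | F₀]) (ENNReal.ofReal (p / 2)) μ := lpNorm_nonneg
  rw [← Real.rpow_le_rpow_iff lpNorm_nonneg (by positivity) hp0, ← Real.rpow_mul (by positivity),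
    one_div_mul_cancel hp0.ne', Real.rpow_one]
  refine h1.trans ?_
  have hC : 0 ≤ taylorConst p * w :=
    mul_nonneg (taylorConst_nonneg hp) (by linarith [h.2.1])
  have e1 := Real.rpow_le_rpow lpNorm_nonneg hUS hp0.le
  have e2 := Real.rpow_le_rpow lpNorm_nonneg hUS (by linarith : 0 ≤ p - 1)
  have e3 := Real.rpow_le_rpow lpNorm_nonneg hUS (by linarith : 0 ≤ p - 2)
  have f2 := mul_le_mul_of_nonneg_left (mul_le_mul_of_nonneg_right e2
    (lpNorm_nonneg (f := μ[S | F₀]) (p := ENNReal.ofReal p) (μ := μ))) hp0.le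
  have f3 := mul_le_mul_of_nonneg_left (mul_le_mul_of_nonneg_right e3
    (lpNorm_nonneg (f := μ[fun ω => S ω ^ 2 | F₀]) (p := ENNReal.ofReal (p / 2)) (μ := μ))) hC
  linarith

end Recurrence

/-! ### Solving the scalar recurrence. -/

section RealRecurrence

/-- The tangent is taken at `x`, so that the additive error `e` gets the coefficient x^{p-1}, the
same shape as the first order term of the recurrence. -/
lemma rpow_le_rpow_add_of_le_add {p x y e : ℝ} (hp : 1 ≤ p) (hx : 0 ≤ x) (hy : 0 ≤ y)
    (he : 0 ≤ e) (h : x ≤ y + e) : x ^ p ≤ y ^ p + p * (x ^ (p - 1) * e) := by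
  rcases le_total x y with hxy | hxy
  · have h1 := Real.rpow_le_rpow hx hxy (by linarith : 0 ≤ p)
    have h2 : 0 ≤ p * (x ^ (p - 1) * e) := by positivity
    linarith
  · rcases hx.eq_or_lt with rfl | hx0
    · have : y = 0 := le_antisymm hxy hy
      rw [this]
      have h2 : 0 ≤ p * ((0 : ℝ) ^ (p - 1) * e) := by positivity
      linarith
    · have hb := one_add_mul_self_le_rpow_one_add (s := y / x - 1) (p := p)
        (by have : 0 ≤ y / x := by positivity
            linarith) hp
      rw [add_sub_cancel, Real.div_rpow hy hx] at hb
      have hpos : 0 < x ^ p := Real.rpow_pos_of_pos hx0 p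
      have h1 := mul_le_mul_of_nonneg_left hb hpos.le
      rw [mul_div_cancel₀ _ hpos.ne'] at h1
      have h2 : x ^ p = x ^ (p - 1) * x := by
        rw [← Real.rpow_add_one hx0.ne']; congr 1; ring
      have h3 : x ^ p * (1 + p * (y / x - 1)) = x ^ p + p * (x ^ (p - 1) * (y - x)) := by
        rw [h2]; field_simp
      have h4 : x ^ (p - 1) * (x - y) ≤ x ^ (p - 1) * e := by
        gcongr; linarith
      have h5 : p * (x ^ (p - 1) * (x - y)) ≤ p * (x ^ (p - 1) * e) := by gcongr
      rw [h3] at h1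
      linarith

/-- If K exceeded the bound, then √D ≤ K, and each term on the right of `h` would be at most K^{p-1}
times a, B or √D; dividing by K^{p-1} gives a contradiction. -/
lemma le_of_rpow_le_lower {p K a B D : ℝ} (hp : 2 < p) (ha : 0 ≤ a) (haK : a ≤ K)
    (hB : 0 ≤ B) (hD : 0 ≤ D)
    (h : K ^ p / 2 ≤ a ^ p + K ^ (p - 1) * B + K ^ (p - 2) * D) :
    K ≤ 2 * (a + B + D ^ (1 / 2 : ℝ)) := by
  have hK := ha.trans haK
  rw [← Real.sqrt_eq_rpow]
  have hs := Real.sqrt_nonneg D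
  by_contra! hlt
  have hK0 : 0 < K := by linarith
  have hsK : √D ≤ K := by linarith
  have e1 : K ^ p = K ^ (p - 1) * K := by
    rw [← Real.rpow_add_one hK0.ne']; congr 1; ring
  have e2 : K ^ (p - 1) = K ^ (p - 2) * K := by
    rw [← Real.rpow_add_one hK0.ne']; congr 1; ring
  have h1 : a ^ p ≤ K ^ (p - 1) * a := by
    rcases ha.eq_or_lt with rfl | ha0
    · rw [Real.zero_rpow (by linarith)]; simp
    · have : a ^ p = a ^ (p - 1) * a := by
        rw [← Real.rpow_add_one ha0.ne']; congr 1; ring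
      rw [this]
      gcongr
      linarith
  have h2 : K ^ (p - 2) * D ≤ K ^ (p - 1) * √D := by
    rw [e2]
    calc K ^ (p - 2) * D = K ^ (p - 2) * (√D * √D) := by rw [Real.mul_self_sqrt hD]
      _ ≤ K ^ (p - 2) * (K * √D) := by gcongr
      _ = _ := by ring
  have hpos : 0 < K ^ (p - 1) := Real.rpow_pos_of_pos hK0 _
  rw [e1] at h
  have h3 : K ^ (p - 1) * (K / 2) ≤ K ^ (p - 1) * (a + B + √D) := by linarith
  have := le_of_mul_le_mul_left h3 hpos
  linarith

/-- All α_l are replaced by their maximum K, attained at some L, and the p-th powers are telescoped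
up to L. The ε-terms then contribute at most K^p / 2 in total and move to the left side, leaving an
inequality for K alone. -/
lemma le_of_dyadic_recurrence {p C : ℝ} (hp : 2 < p) (hC : 0 ≤ C) {R : ℕ} {α u e b ε w : ℕ → ℝ}
    (hα : ∀ l, 0 ≤ α l) (hu : ∀ l, 0 ≤ u l) (he : ∀ l, 0 ≤ e l) (hb : ∀ l, 0 ≤ b l)
    (hε : ∀ l, 0 ≤ ε l) (hw : ∀ l, 0 ≤ w l) (hεsum : ∑ l ∈ Finset.range R, ε l ≤ 1)
    (hrec : ∀ l < R, α (l + 1) ≤ ((1 + ε l / 2) * α l ^ p + p / 2 * (α l ^ (p - 1) * u l) +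
      C * w l / 2 * (α l ^ (p - 2) * b l)) ^ (1 / p) + e l) {l : ℕ} (hl : l ≤ R) :
    α l ≤ 2 * (α 0 + p * (∑ l ∈ Finset.range R, u l + ∑ l ∈ Finset.range R, e l) +
      (C * ∑ l ∈ Finset.range R, w l * b l) ^ (1 / 2 : ℝ)) := by
  have hp0 : 0 < p := by linarith
  obtain ⟨L, hL, hmax⟩ := Finset.exists_max_image (Finset.range (R + 1)) α ⟨0, by simp⟩
  have hmax' : ∀ l ≤ R, α l ≤ α L := fun l hl => hmax l (Finset.mem_range.2 (by omega))
  refine (hmax' l hl).trans ?_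
  set K := α L with hK
  have hK0 : 0 ≤ K := hα L
  set g : ℕ → ℝ := fun l => K ^ p / 2 * ε l + K ^ (p - 1) * (p * (u l + e l)) +
    K ^ (p - 2) * (C * (w l * b l)) with hg
  have hg0 : ∀ l, 0 ≤ g l := fun l => by
    have := hu l; have := he l; have := hb l; have := hε l; have := hw l
    positivity
  have hstep : ∀ l < R, α (l + 1) ^ p ≤ α l ^ p + g l := by
    intro l hl
    have a0 := hα l
    have u0 := hu l; have e0 := he l; have b0 := hb l; have ε0 := hε l; have w0 := hw l
    have hlK := hmax' l hl.le
    have hlK' := hmax' (l + 1) hl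
    have h1 := rpow_le_rpow_add_of_le_add (by linarith : 1 ≤ p) (hα (l + 1)) (by positivity) e0
      (hrec l hl)
    rw [← Real.rpow_mul (by positivity), one_div_mul_cancel hp0.ne', Real.rpow_one] at h1
    have k1 : α l ^ p ≤ K ^ p := Real.rpow_le_rpow a0 hlK hp0.le
    have k2 : α l ^ (p - 1) ≤ K ^ (p - 1) := Real.rpow_le_rpow a0 hlK (by linarith)
    have k3 : α l ^ (p - 2) ≤ K ^ (p - 2) := Real.rpow_le_rpow a0 hlK (by linarith)
    have k4 : α (l + 1) ^ (p - 1) ≤ K ^ (p - 1) :=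
      Real.rpow_le_rpow (hα _) hlK' (by linarith)
    have m1 : ε l / 2 * α l ^ p ≤ ε l / 2 * K ^ p := by gcongr
    have m2 : p / 2 * (α l ^ (p - 1) * u l) ≤ p * (K ^ (p - 1) * u l) := by
      gcongr; linarith
    have m3 : C * w l / 2 * (α l ^ (p - 2) * b l) ≤ C * w l * (K ^ (p - 2) * b l) := by
      gcongr
      exact half_le_self (by positivity)
    have m4 : p * (α (l + 1) ^ (p - 1) * e l) ≤ p * (K ^ (p - 1) * e l) := by gcongr
    simp only [hg]
    linarith
  have hiter : ∀ l ≤ R, α l ^ p ≤ α 0 ^ p + ∑ i ∈ Finset.range l, g i := by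
    intro l
    induction l with
    | zero => intro _; simp
    | succ l ih =>
      intro hl
      rw [Finset.sum_range_succ]
      linarith [hstep l (by omega), ih (by omega)]
  have hLR : L ≤ R := by have := Finset.mem_range.1 hL; omega
  have h1 : K ^ p ≤ α 0 ^ p + ∑ i ∈ Finset.range R, g i := by
    refine (hiter L hLR).trans (add_le_add_right ?_ _)
    exact Finset.sum_le_sum_of_subset_of_nonneg
      (Finset.range_subset_range.2 hLR) fun i _ _ => hg0 i
  have h2 : ∑ i ∈ Finset.range R, g i = K ^ p / 2 * ∑ l ∈ Finset.range R, ε l +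
      K ^ (p - 1) * (p * (∑ l ∈ Finset.range R, u l + ∑ l ∈ Finset.range R, e l)) +
      K ^ (p - 2) * (C * ∑ l ∈ Finset.range R, w l * b l) := by
    simp only [hg, Finset.sum_add_distrib, Finset.mul_sum, mul_add]
  have h3 : K ^ p / 2 * ∑ l ∈ Finset.range R, ε l ≤ K ^ p / 2 :=
    mul_le_of_le_one_right (by positivity) hεsum
  refine le_of_rpow_le_lower hp (hα 0) (hmax' 0 (by omega)) ?_ ?_ (by linarith)
  · have := Finset.sum_nonneg fun l (_ : l ∈ Finset.range R) => hu l
    have := Finset.sum_nonneg fun l (_ : l ∈ Finset.range R) => he l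
    positivity
  · have := Finset.sum_nonneg fun l (_ : l ∈ Finset.range R) => mul_nonneg (hw l) (hb l)
    positivity

end RealRecurrence

/-! ### Choice of weights, and sums over dyadic scales. -/

section DyadicSums

lemma sum_range_le_tsum_of_summable {f : ℕ → ℝ} (hf : Summable f) (h0 : ∀ i, 0 ≤ f i) (R : ℕ) :
    ∑ l ∈ Finset.range R, f l ≤ ∑' l, f l :=
  hf.sum_le_tsum _ fun i _ => h0 i

/-- For p > 3, ε_l = c ((l+1)^{-s} + q^{R-l}) with s = γ/(p-3) > 1 and q = ρ^{-1/(p-3)}. Both parts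
have sums bounded independently of R, which fixes c. Each part alone bounds ε_l from below, so
ε_l^{-(p-3)} is at most a constant times (l+1)^γ and also times ρ^{R-l}. The case l = 0 is listed
apart because l^γ vanishes there. -/
lemma exists_absorbing_weights {p γ ρ : ℝ}
    (hγ : (p ≤ 3 ∧ γ = 0) ∨ (3 < p ∧ p - 3 < γ)) (hρ : 1 < ρ) :
    ∃ D : ℝ, 1 ≤ D ∧ ∀ R : ℕ, ∃ ε w : ℕ → ℝ, (∀ l, Absorbs p (ε l) (w l)) ∧
      ∑ l ∈ Finset.range R, ε l ≤ 1 ∧ w 0 ≤ D ∧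
      (∀ l, 1 ≤ l → w l ≤ D * (l : ℝ) ^ γ) ∧ ∀ l, w l ≤ D * ρ ^ (R - l) := by
  rcases hγ with ⟨h3, rfl⟩ | ⟨h3, hγ⟩
  · refine ⟨1, le_rfl, fun R => ⟨fun _ => 0, fun _ => 1, fun l => ⟨le_rfl, le_rfl, Or.inl h3⟩,
      by simp, le_rfl, fun l _ => by simp, fun l => ?_⟩⟩
    rw [one_mul]; exact one_le_pow₀ hρ.le
  · have hκ : 0 < p - 3 := by linarith
    set κ := p - 3 with hκdef
    have hγ0 : 0 < γ := by linarith
    have hs : 1 < γ / κ := by rwa [one_lt_div hκ]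
    set s := γ / κ with hsdef
    set q : ℝ := (ρ ^ (1 / κ))⁻¹ with hq
    have hρ0 : 0 < ρ := by linarith
    have hρκ : 1 < ρ ^ (1 / κ) := Real.one_lt_rpow hρ (by positivity)
    have hq0 : 0 < q := by positivity
    have hq1 : q < 1 := inv_lt_one_of_one_lt₀ hρκ
    have sum1 : Summable fun l : ℕ => (((l + 1 : ℕ) : ℝ) ^ s)⁻¹ :=
      (summable_nat_add_iff 1).2 (Real.summable_nat_rpow_inv.2 hs)
    have sum2 : Summable fun l : ℕ => q ^ l := summable_geometric_of_lt_one hq0.le hq1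
    set A := ∑' l : ℕ, (((l + 1 : ℕ) : ℝ) ^ s)⁻¹ with hA
    set B := ∑' l : ℕ, q ^ l with hB
    have hA0 : 0 < A := sum1.tsum_pos (fun i => by positivity) 0 (by simp)
    have hB0 : 0 < B := sum2.tsum_pos (fun i => by positivity) 0 (by simp)
    set c := (A + B)⁻¹ with hc
    have hc0 : 0 < c := by positivity
    -- The factor 2^γ pays for (l+1)^γ ≤ 2^γ l^γ when l ≥ 1.
    refine ⟨1 + c ^ (-κ) * 2 ^ γ, by
      have : 0 ≤ c ^ (-κ) * 2 ^ γ := by positivity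
      linarith, fun R => ?_⟩
    set D := 1 + c ^ (-κ) * 2 ^ γ with hD
    have hD1 : 1 ≤ D := by
      have : 0 ≤ c ^ (-κ) * 2 ^ γ := by positivity
      linarith
    have h2γ : (1 : ℝ) ≤ 2 ^ γ := Real.one_le_rpow one_le_two hγ0.le
    have hcD : c ^ (-κ) ≤ D := by
      have : 0 ≤ c ^ (-κ) := by positivity
      nlinarith
    set ε : ℕ → ℝ := fun l => c * ((((l + 1 : ℕ) : ℝ) ^ s)⁻¹ + q ^ (R - l)) with hε
    have hε0 : ∀ l, 0 < ε l := fun l => by positivity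
    have hε1 : ∀ l, ε l ^ (-κ) ≤ c ^ (-κ) * ((l + 1 : ℕ) : ℝ) ^ γ := by
      intro l
      have h1 : c * (((l + 1 : ℕ) : ℝ) ^ s)⁻¹ ≤ ε l := by
        simp only [hε]; gcongr; linarith [pow_pos hq0 (R - l)]
      refine (Real.rpow_le_rpow_of_nonpos (by positivity) h1 (by linarith)).trans (le_of_eq ?_)
      rw [Real.mul_rpow hc0.le (by positivity), ← Real.rpow_neg (by positivity),
        ← Real.rpow_mul (by positivity)]
      congr 2
      rw [neg_mul_neg, hsdef, div_mul_cancel₀ _ hκ.ne']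
    have hε2 : ∀ l, ε l ^ (-κ) ≤ c ^ (-κ) * ρ ^ (R - l) := by
      intro l
      have h1 : c * q ^ (R - l) ≤ ε l := by
        simp only [hε]; gcongr; linarith [show 0 ≤ (((l + 1 : ℕ) : ℝ) ^ s)⁻¹ by positivity]
      refine (Real.rpow_le_rpow_of_nonpos (by positivity) h1 (by linarith)).trans (le_of_eq ?_)
      rw [Real.mul_rpow hc0.le (by positivity)]
      congr 1
      rw [Real.rpow_neg (by positivity), hq, inv_pow, Real.inv_rpow (by positivity), inv_inv,
        ← Real.rpow_natCast (ρ ^ (1 / κ)), ← Real.rpow_mul hρ0.le, ← Real.rpow_mul hρ0.le,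
        ← Real.rpow_natCast ρ]
      congr 1; field_simp
    refine ⟨ε, fun l => max 1 (ε l ^ (-κ)), fun l =>
      ⟨(hε0 l).le, le_max_left _ _, Or.inr ⟨hε0 l, le_max_right _ _⟩⟩, ?_, ?_, ?_, ?_⟩
    · simp only [hε, ← Finset.mul_sum, Finset.sum_add_distrib]
      have t1 := sum_range_le_tsum_of_summable sum1 (fun i => by positivity) R
      have t2 : ∑ l ∈ Finset.range R, q ^ (R - l) ≤ B := by
        have h1 : ∑ l ∈ Finset.range R, q ^ (R - l) ≤ ∑ l ∈ Finset.range (R + 1), q ^ (R - l) :=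
          Finset.sum_le_sum_of_subset_of_nonneg
            (Finset.range_subset_range.2 (Nat.le_succ R)) fun i _ _ => by positivity
        rw [Finset.sum_flip fun l => q ^ l] at h1
        exact h1.trans (sum_range_le_tsum_of_summable sum2 (fun i => by positivity) _)
      calc _ ≤ c * (A + B) := by gcongr
        _ = 1 := inv_mul_cancel₀ (by positivity)
    · refine max_le hD1 ((hε1 0).trans ?_)
      simpa using hcD
    · intro l hl
      have hl1 : (1 : ℝ) ≤ l := by exact_mod_cast hl
      have hlγ : (1 : ℝ) ≤ (l : ℝ) ^ γ := Real.one_le_rpow hl1 hγ0.le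
      refine max_le (one_le_mul_of_one_le_of_one_le hD1 hlγ) ((hε1 l).trans ?_)
      have h1 : ((l + 1 : ℕ) : ℝ) ^ γ ≤ 2 ^ γ * (l : ℝ) ^ γ := by
        rw [← Real.mul_rpow (by norm_num) (by linarith)]
        exact Real.rpow_le_rpow (by positivity) (by push_cast; linarith) hγ0.le
      calc c ^ (-κ) * ((l + 1 : ℕ) : ℝ) ^ γ ≤ c ^ (-κ) * (2 ^ γ * (l : ℝ) ^ γ) := by gcongr
        _ = (c ^ (-κ) * 2 ^ γ) * (l : ℝ) ^ γ := by ring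
        _ ≤ D * (l : ℝ) ^ γ := by gcongr; linarith
    · intro l
      have h1 : 1 ≤ ρ ^ (R - l) := one_le_pow₀ hρ.le
      refine max_le (one_le_mul_of_one_le_of_one_le hD1 h1) ((hε2 l).trans ?_)
      gcongr

lemma summable_rpow_mul_geometric {γ q : ℝ} (hq0 : 0 ≤ q) (hq1 : q < 1) :
    Summable fun i : ℕ => ((1 + i : ℕ) : ℝ) ^ γ * q ^ i := by
  rcases hq0.eq_or_lt with rfl | hq0
  · refine summable_of_ne_finset_zero (s := {0}) fun i hi => ?_
    rw [zero_pow (by simpa using hi), mul_zero]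
  have h1 : Summable fun i : ℕ => ((i + 1 : ℕ) : ℝ) ^ ⌈γ⌉₊ * q ^ (i + 1) :=
    (summable_nat_add_iff 1).2 (summable_pow_mul_geometric_of_norm_lt_one ⌈γ⌉₊ (r := q)
      (by rwa [Real.norm_eq_abs, abs_of_pos hq0]))
  refine Summable.of_nonneg_of_le (fun i => by positivity) (fun i => ?_) (h1.mul_right q⁻¹)
  rw [pow_succ, mul_assoc, mul_assoc, mul_inv_cancel₀ hq0.ne', mul_one, add_comm 1 i,
    ← Real.rpow_natCast _ ⌈γ⌉₊]
  refine mul_le_mul_of_nonneg_right (Real.rpow_le_rpow_of_exponent_le ?_ (Nat.le_ceil γ))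
    (by positivity)
  exact_mod_cast Nat.le_add_left 1 i

/-- The sum of `l^γ 2^{-ls}` over `l ≥ m` is of the order of its first term. -/
lemma exists_tail_sum_le {γ s : ℝ} (hγ : 0 ≤ γ) (hs : 0 < s) :
    ∃ A : ℝ, 0 ≤ A ∧ ∀ R m : ℕ,
      ∑ l ∈ Finset.range R, (if m ≤ l then (l : ℝ) ^ γ * ((2 : ℝ) ^ l) ^ (-s) else 0) ≤
        A * (((max 1 m : ℕ) : ℝ) ^ γ * ((2 : ℝ) ^ m) ^ (-s)) := by
  set q : ℝ := 2 ^ (-s) with hq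
  have hq0 : 0 < q := by positivity
  have hq1 : q < 1 := Real.rpow_lt_one_of_one_lt_of_neg one_lt_two (by linarith)
  have hsum := summable_rpow_mul_geometric (γ := γ) hq0.le hq1
  have hpow : ∀ l : ℕ, ((2 : ℝ) ^ l) ^ (-s) = q ^ l := fun l => by
    rw [hq, ← Real.rpow_natCast, ← Real.rpow_natCast, ← Real.rpow_mul (by norm_num),
      ← Real.rpow_mul (by norm_num), mul_comm]
  refine ⟨∑' i : ℕ, ((1 + i : ℕ) : ℝ) ^ γ * q ^ i, tsum_nonneg fun i => by positivity,
    fun R m => ?_⟩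
  simp only [hpow]
  set c := ((max 1 m : ℕ) : ℝ) ^ γ * q ^ m with hc
  have hc0 : 0 ≤ c := by positivity
  -- From m + i ≤ (1 + i) max(1, m) the first term factors out and leaves a convergent series in
  -- `i`; the `max` covers m = 0.
  have hterm : ∀ i : ℕ, ((m + i : ℕ) : ℝ) ^ γ * q ^ (m + i) ≤
      (((1 + i : ℕ) : ℝ) ^ γ * q ^ i) * c := by
    intro i
    have h1 : ((m + i : ℕ) : ℝ) ≤ ((1 + i : ℕ) : ℝ) * ((max 1 m : ℕ) : ℝ) := by
      have : m + i ≤ (1 + i) * max 1 m := by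
        have h1 : 1 ≤ max 1 m := le_max_left _ _
        have h2 : m ≤ max 1 m := le_max_right _ _
        nlinarith
      exact_mod_cast this
    have h2 := Real.rpow_le_rpow (by positivity) h1 hγ
    rw [Real.mul_rpow (by positivity) (by positivity)] at h2
    rw [pow_add, hc]
    have h3 := mul_le_mul_of_nonneg_right h2 (by positivity : 0 ≤ q ^ m * q ^ i)
    linarith
  calc ∑ l ∈ Finset.range R, (if m ≤ l then (l : ℝ) ^ γ * q ^ l else 0)
      ≤ ∑ l ∈ Finset.range (m + R), (if m ≤ l then (l : ℝ) ^ γ * q ^ l else 0) :=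
        Finset.sum_le_sum_of_subset_of_nonneg (Finset.range_subset_range.2 (by omega))
          fun i _ _ => by split_ifs <;> positivity
    _ = ∑ i ∈ Finset.range R, ((m + i : ℕ) : ℝ) ^ γ * q ^ (m + i) := by
        rw [Finset.sum_range_add]
        rw [Finset.sum_eq_zero fun l hl => if_neg (by have := Finset.mem_range.1 hl; omega),
          zero_add]
        exact Finset.sum_congr rfl fun i _ => if_pos (by omega)
    _ ≤ ∑ i ∈ Finset.range R, (((1 + i : ℕ) : ℝ) ^ γ * q ^ i) * c :=
        Finset.sum_le_sum fun i _ => hterm i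
    _ ≤ _ := by
        rw [← Finset.sum_mul]
        exact mul_le_mul_of_nonneg_right
          (sum_range_le_tsum_of_summable hsum (fun i => by positivity) R) hc0

/-- Interchange of summations: j ≤ 2^l exactly when `Nat.clog 2 j ≤ l`. -/
lemma sum_dyadic_eq {f : ℕ → ℝ} {d : ℕ → ℝ} {R n : ℕ} (hn : ∀ l < R, 2 ^ l ≤ n) :
    ∑ l ∈ Finset.range R, f l * ∑ j ∈ Finset.Icc 1 (2 ^ l), d j =
      ∑ j ∈ Finset.Icc 1 n, (∑ l ∈ Finset.range R, if Nat.clog 2 j ≤ l then f l else 0) * d j := by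
  simp_rw [Finset.sum_mul, Finset.mul_sum]
  rw [Finset.sum_comm]
  refine Finset.sum_congr rfl fun l hl => ?_
  have hl' := hn l (Finset.mem_range.1 hl)
  have hsub : Finset.Icc 1 (2 ^ l) ⊆ Finset.Icc 1 n := Finset.Icc_subset_Icc le_rfl hl'
  rw [← Finset.sum_subset hsub]
  · refine Finset.sum_congr rfl fun j hj => ?_
    rw [if_pos (Nat.clog_le_of_le_pow (Finset.mem_Icc.1 hj).2)]
  · intro j hj hj'
    rw [if_neg, zero_mul]
    intro h
    refine hj' (Finset.mem_Icc.2 ⟨(Finset.mem_Icc.1 hj).1, ?_⟩)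
    exact (Nat.le_pow_clog one_lt_two j).trans (Nat.pow_le_pow_right two_pos h)

lemma rpow_neg_two_pow_clog_le {s : ℝ} (hs : 0 < s) {j : ℕ} (hj : 1 ≤ j) :
    ((2 : ℝ) ^ Nat.clog 2 j) ^ (-s) ≤ (j : ℝ) ^ (-s) := by
  refine Real.rpow_le_rpow_of_nonpos (by exact_mod_cast hj) ?_ (by linarith)
  exact_mod_cast Nat.le_pow_clog one_lt_two j

/-- Rounding up adds at most 1 to log j / log 2, and that is absorbed by doubling because j ≥ 2. -/
lemma clog_le_mul_log {j : ℕ} (hj : 2 ≤ j) :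
    ((max 1 (Nat.clog 2 j) : ℕ) : ℝ) ≤ 2 / Real.log 2 * Real.log j := by
  have hlog2 : 0 < Real.log 2 := Real.log_pos one_lt_two
  have hlogj : Real.log 2 ≤ Real.log j :=
    Real.log_le_log two_pos (by exact_mod_cast hj)
  have hc1 : 1 ≤ Nat.clog 2 j := Nat.clog_pos one_lt_two hj
  rw [max_eq_right hc1]
  have h1 : 2 ^ (Nat.clog 2 j).pred < j := Nat.pow_pred_clog_lt_self one_lt_two (by omega)
  have h2 : ((Nat.clog 2 j).pred : ℝ) * Real.log 2 ≤ Real.log j := by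
    rw [← Real.log_pow]
    exact Real.log_le_log (by positivity) (by exact_mod_cast h1.le)
  have h3 : ((Nat.clog 2 j : ℕ) : ℝ) = ((Nat.clog 2 j).pred : ℝ) + 1 := by
    have : Nat.clog 2 j = (Nat.clog 2 j).pred + 1 := by
      rw [Nat.pred_eq_sub_one]; omega
    exact_mod_cast this
  rw [h3, div_mul_eq_mul_div, le_div_iff₀ hlog2]
  linarith

/-- Sums over dyadic scales of partial sums reduce to one weighted sum. -/
lemma exists_dyadic_sum_le {γ s : ℝ} (hγ : 0 ≤ γ) (hs : 0 < s) :
    ∃ A : ℝ, 0 ≤ A ∧ ∀ (R n : ℕ) (d : ℕ → ℝ), (∀ j, 0 ≤ d j) → (∀ l < R, 2 ^ l ≤ n) →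
      ∑ l ∈ Finset.range R, ((l : ℝ) ^ γ * ((2 : ℝ) ^ l) ^ (-s)) *
          ∑ j ∈ Finset.Icc 1 (2 ^ l), d j ≤
        A * (d 1 + ∑ j ∈ Finset.Icc 1 n, (j : ℝ) ^ (-s) * Real.log j ^ γ * d j) := by
  obtain ⟨A, hA, h⟩ := exists_tail_sum_le hγ hs
  have hlog2 : 0 < Real.log 2 := Real.log_pos one_lt_two
  set c : ℝ := (2 / Real.log 2) ^ γ with hc
  have hc0 : 0 ≤ c := by positivity
  refine ⟨A * (1 + c), by positivity, fun R n d hd hn => ?_⟩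
  rw [sum_dyadic_eq hn]
  have hlogj : ∀ j : ℕ, 0 ≤ Real.log j := fun j => Real.log_natCast_nonneg j
  have hterm : ∀ j ∈ Finset.Icc 1 n, (∑ l ∈ Finset.range R,
      if Nat.clog 2 j ≤ l then (l : ℝ) ^ γ * ((2 : ℝ) ^ l) ^ (-s) else 0) * d j ≤
      A * ((if j = 1 then d 1 else 0) + c * ((j : ℝ) ^ (-s) * Real.log j ^ γ * d j)) := by
    intro j hj
    have hj1 := (Finset.mem_Icc.1 hj).1
    have h1 := mul_le_mul_of_nonneg_right (h R (Nat.clog 2 j)) (hd j)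
    refine h1.trans ?_
    rw [mul_assoc]
    refine mul_le_mul_of_nonneg_left ?_ hA
    have hnn : 0 ≤ c * ((j : ℝ) ^ (-s) * Real.log j ^ γ * d j) := by
      have := hd j; have := hlogj j
      positivity
    -- At j = 1 the factor (log 1)^γ vanishes for γ > 0, so this index is paid for by the separate
    -- term `d 1`.
    rcases hj1.eq_or_lt with rfl | hj2
    · simp only [Nat.clog_one_right] at *
      simpa using hnn
    · rw [if_neg (by omega), zero_add]
      have h2 : ((max 1 (Nat.clog 2 j) : ℕ) : ℝ) ^ γ ≤ c * Real.log j ^ γ := by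
        rw [hc, ← Real.mul_rpow (by positivity) (hlogj j)]
        exact Real.rpow_le_rpow (by positivity) (clog_le_mul_log hj2) hγ
      have h3 := rpow_neg_two_pow_clog_le hs hj1
      have h4 : 0 ≤ Real.log j ^ γ := Real.rpow_nonneg (hlogj j) _
      calc _ ≤ (c * Real.log j ^ γ) * (j : ℝ) ^ (-s) * d j := by
            gcongr
            exact hd j
        _ = _ := by ring
  refine (Finset.sum_le_sum hterm).trans ?_
  rw [← Finset.mul_sum, Finset.sum_add_distrib, ← Finset.mul_sum, mul_assoc]
  refine mul_le_mul_of_nonneg_left ?_ hA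
  set Q := ∑ j ∈ Finset.Icc 1 n, (j : ℝ) ^ (-s) * Real.log j ^ γ * d j with hQ
  have hQ0 : 0 ≤ Q := Finset.sum_nonneg fun j _ => by
    have := hd j; have := hlogj j
    positivity
  have h5 : ∑ j ∈ Finset.Icc 1 n, (if j = 1 then d 1 else 0) ≤ d 1 := by
    rw [Finset.sum_ite_eq' (Finset.Icc 1 n) 1]
    split_ifs
    · exact le_rfl
    · exact hd 1
  have h6 : 0 ≤ c * d 1 := mul_nonneg hc0 (hd 1)
  linarith

end DyadicSums

/-! ### Counting in double sums. -/

section SymmetricSums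

lemma sum_symm_le {β : ℕ → ℕ → ℝ} (h0 : ∀ a b, 0 ≤ β a b) (hs : ∀ a b, β a b = β b a) (k : ℕ) :
    ∑ a ∈ Finset.Icc 1 k, ∑ b ∈ Finset.Icc 1 k, β a b ≤
      2 * ∑ a ∈ Finset.Icc 1 k, ∑ i ∈ Finset.range k, β a (a + i) := by
  set h : ℕ → ℕ → ℝ := fun a b => if a ≤ b then β a b else 0 with hh
  have h1 : ∀ a b, β a b ≤ h a b + h b a := by
    intro a b
    simp only [hh]
    rcases le_total a b with hab | hab
    · rw [if_pos hab]
      split_ifs <;> linarith [h0 b a]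
    · rw [if_pos hab, hs a b]
      split_ifs <;> linarith [h0 b a]
  have h2 : ∀ a ∈ Finset.Icc 1 k, ∑ b ∈ Finset.Icc 1 k, h a b ≤
      ∑ i ∈ Finset.range k, β a (a + i) := by
    intro a ha
    have ha1 := (Finset.mem_Icc.1 ha).1
    have e : (Finset.Icc 1 k).filter (fun b => a ≤ b) = Finset.Ico a (k + 1) := by
      ext b; simp only [Finset.mem_filter, Finset.mem_Icc, Finset.mem_Ico]; omega
    simp only [hh]
    rw [← Finset.sum_filter, e, Finset.sum_Ico_eq_sum_range]
    exact Finset.sum_le_sum_of_subset_of_nonneg (Finset.range_subset_range.2 (by omega))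
      fun i _ _ => h0 _ _
  calc ∑ a ∈ Finset.Icc 1 k, ∑ b ∈ Finset.Icc 1 k, β a b
      ≤ ∑ a ∈ Finset.Icc 1 k, ∑ b ∈ Finset.Icc 1 k, (h a b + h b a) :=
        Finset.sum_le_sum fun a _ => Finset.sum_le_sum fun b _ => h1 a b
    _ = 2 * ∑ a ∈ Finset.Icc 1 k, ∑ b ∈ Finset.Icc 1 k, h a b := by
        simp only [Finset.sum_add_distrib]
        rw [Finset.sum_comm (f := fun a b => h b a)]
        ring
    _ ≤ _ := mul_le_mul_of_nonneg_left (Finset.sum_le_sum h2) zero_le_two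

/-- A value j ≥ 1 of max(a, i) comes from a = j with at most j + 1 ≤ 2j choices of i, or from i = j
with at most j choices of a. -/
lemma sum_max_le {A : ℕ → ℝ} (h0 : ∀ a, 0 ≤ A a) (k : ℕ) :
    ∑ a ∈ Finset.Icc 1 k, ∑ i ∈ Finset.range k, A (max a i) ≤
      3 * ∑ a ∈ Finset.Icc 1 k, a * A a := by
  have h1 : ∀ a i : ℕ, A (max a i) ≤ (if i ≤ a then A a else 0) + if a ≤ i then A i else 0 := by
    intro a i
    rcases le_total a i with h | h
    · rw [max_eq_right h, if_pos h]
      split_ifs <;> linarith [h0 a]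
    · rw [max_eq_left h, if_pos h]
      split_ifs <;> linarith [h0 i]
  have h2 : ∀ a ∈ Finset.Icc 1 k, ∑ i ∈ Finset.range k, (if i ≤ a then A a else 0) ≤
      2 * (a * A a) := by
    intro a ha
    have ha1 : (1 : ℝ) ≤ a := by exact_mod_cast (Finset.mem_Icc.1 ha).1
    have hcard : ((Finset.range k).filter (fun i => i ≤ a)).card ≤ a + 1 := by
      refine (Finset.card_le_card (t := Finset.range (a + 1)) fun i hi => ?_).trans (by simp)
      rw [Finset.mem_range]
      have := (Finset.mem_filter.1 hi).2
      omega
    rw [← Finset.sum_filter, Finset.sum_const, nsmul_eq_mul]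
    have hcard' : (((Finset.range k).filter (fun i => i ≤ a)).card : ℝ) ≤ a + 1 := by
      exact_mod_cast hcard
    have := mul_le_mul_of_nonneg_right hcard' (h0 a)
    nlinarith [h0 a]
  have h3 : ∀ i ∈ Finset.range k, ∑ a ∈ Finset.Icc 1 k, (if a ≤ i then A i else 0) ≤
      i * A i := by
    intro i hi
    have hcard : ((Finset.Icc 1 k).filter (fun a => a ≤ i)).card ≤ i := by
      refine (Finset.card_le_card (t := Finset.Icc 1 i) fun a ha => ?_).trans (by simp)
      rw [Finset.mem_Icc]
      exact ⟨(Finset.mem_Icc.1 (Finset.mem_filter.1 ha).1).1, (Finset.mem_filter.1 ha).2⟩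
    rw [← Finset.sum_filter, Finset.sum_const, nsmul_eq_mul]
    have hcard' : (((Finset.Icc 1 k).filter (fun a => a ≤ i)).card : ℝ) ≤ i := by
      exact_mod_cast hcard
    exact mul_le_mul_of_nonneg_right hcard' (h0 i)
  have h4 : ∑ i ∈ Finset.range k, (i : ℝ) * A i ≤ ∑ a ∈ Finset.Icc 1 k, (a : ℝ) * A a := by
    have e : ∑ i ∈ Finset.range k, (i : ℝ) * A i =
        ∑ i ∈ (Finset.range k).filter (fun i => 1 ≤ i), (i : ℝ) * A i := by
      symm
      refine Finset.sum_filter_of_ne fun i _ hne => ?_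
      by_contra h
      have : i = 0 := by omega
      subst this
      simp at hne
    rw [e]
    refine Finset.sum_le_sum_of_subset_of_nonneg (fun i hi => ?_)
      fun i _ _ => mul_nonneg (Nat.cast_nonneg i) (h0 i)
    have := Finset.mem_filter.1 hi
    have h5 := Finset.mem_range.1 this.1
    exact Finset.mem_Icc.2 ⟨this.2, h5.le⟩
  calc _ ≤ ∑ a ∈ Finset.Icc 1 k, ∑ i ∈ Finset.range k,
        ((if i ≤ a then A a else 0) + if a ≤ i then A i else 0) :=
        Finset.sum_le_sum fun a _ => Finset.sum_le_sum fun i _ => h1 a i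
    _ = ∑ a ∈ Finset.Icc 1 k, ∑ i ∈ Finset.range k, (if i ≤ a then A a else 0) +
        ∑ i ∈ Finset.range k, ∑ a ∈ Finset.Icc 1 k, (if a ≤ i then A i else 0) := by
        simp only [Finset.sum_add_distrib]
        rw [Finset.sum_comm (s := Finset.range k)]
    _ ≤ ∑ a ∈ Finset.Icc 1 k, 2 * (a * A a) + ∑ i ∈ Finset.range k, i * A i :=
        add_le_add (Finset.sum_le_sum h2) (Finset.sum_le_sum h3)
    _ ≤ _ := by rw [← Finset.mul_sum]; linarith

end SymmetricSums

/-! ### Covariances, projections and the coefficients A(X, j). -/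

section Coefficients

variable {Ω : Type*} {F₀ mΩ : MeasurableSpace Ω} {μ : Measure Ω} {T : Ω → Ω} {X₀ : Ω → ℝ} {p : ℝ}

lemma memLp_seq {P : ℝ≥0∞} (hT : MeasurePreserving T μ μ) (hX : MemLp X₀ P μ) (k : ℕ) :
    MemLp (seq T X₀ k) P μ := memLp_iterate hT hX k

lemma lpNorm_seq {P : ℝ≥0∞} (hT : MeasurePreserving T μ μ) (hX : MemLp X₀ P μ) (k : ℕ) :
    lpNorm (seq T X₀ k) P μ = lpNorm X₀ P μ :=
  lpNorm_comp_measurePreserving (hT.iterate k) hX.1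

lemma partialSum_eq_sum (k : ℕ) : partialSum T X₀ k = ∑ j ∈ Finset.Icc 1 k, seq T X₀ j := by
  ext ω; simp [partialSum]

lemma integral_seq_mul_seq (hT : MeasurePreserving T μ μ) (hX : AEStronglyMeasurable X₀ μ)
    (a i : ℕ) : ∫ ω, seq T X₀ a ω * seq T X₀ (a + i) ω ∂μ = ∫ ω, X₀ ω * seq T X₀ i ω ∂μ := by
  have hY : AEStronglyMeasurable (fun ω => X₀ ω * seq T X₀ i ω) μ :=
    hX.mul (hX.comp_measurePreserving (hT.iterate i))
  have hmp := hT.iterate a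
  have h1 : AEStronglyMeasurable (fun ω => X₀ ω * seq T X₀ i ω) (μ.map T^[a]) := by
    rwa [hmp.map_eq]
  have h2 := integral_map hmp.measurable.aemeasurable h1
  rw [hmp.map_eq] at h2
  rw [h2]
  refine integral_congr_ae (Filter.Eventually.of_forall fun ω => ?_)
  simp only [seq]
  rw [add_comm a i, Function.iterate_add_apply]

lemma memLp_seq_mul_seq (hp : 2 < p) (hT : MeasurePreserving T μ μ)
    (hX : MemLp X₀ (ENNReal.ofReal p) μ) (a b : ℕ) :
    MemLp (fun ω => seq T X₀ a ω * seq T X₀ b ω) (ENNReal.ofReal (p / 2)) μ :=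
  memLp_mul_half (by linarith) (memLp_seq hT hX a) (memLp_seq hT hX b)

lemma lpNorm_condExp_seq_mul_seq_le (hp : 2 < p) (hT : MeasurePreserving T μ μ)
    (hX : MemLp X₀ (ENNReal.ofReal p) μ) (a b : ℕ) :
    lpNorm (μ[fun ω => seq T X₀ a ω * seq T X₀ b ω | F₀]) (ENNReal.ofReal (p / 2)) μ ≤
      lpNorm X₀ (ENNReal.ofReal p) μ ^ 2 := by
  have hp2 : 1 ≤ ENNReal.ofReal (p / 2) := by simpa using (by linarith : 1 ≤ p / 2)
  refine ((memLp_seq_mul_seq hp hT hX a b).lpNorm_condExp_le_lpNorm hp2).trans ?_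
  refine (lpNorm_mul_half_le (by linarith) (memLp_seq hT hX a) (memLp_seq hT hX b)).trans ?_
  rw [lpNorm_seq hT hX, lpNorm_seq hT hX, sq]

lemma partialSum_one : partialSum T X₀ 1 = seq T X₀ 1 := by
  rw [partialSum_eq_sum]; simp

lemma lpNorm_condExp_partialSum_one_sq_le (hp : 2 < p) (hT : MeasurePreserving T μ μ)
    (hX : MemLp X₀ (ENNReal.ofReal p) μ) :
    lpNorm (μ[fun ω => partialSum T X₀ 1 ω ^ 2 | F₀]) (ENNReal.ofReal (p / 2)) μ ≤
      lpNorm X₀ (ENNReal.ofReal p) μ ^ 2 := by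
  simp only [partialSum_one, sq (seq T X₀ 1 _)]
  exact lpNorm_condExp_seq_mul_seq_le hp hT hX 1 1

variable [IsProbabilityMeasure μ]

lemma lpNorm_condExp_partialSum_le (hp : 1 ≤ p) (hT : MeasurePreserving T μ μ)
    (hX : MemLp X₀ (ENNReal.ofReal p) μ) (k : ℕ) :
    lpNorm (μ[partialSum T X₀ k | F₀]) (ENNReal.ofReal p) μ ≤
      ∑ j ∈ Finset.Icc 1 k, lpNorm (μ[seq T X₀ j | F₀]) (ENNReal.ofReal p) μ := by
  have hp1 : 1 ≤ ENNReal.ofReal p := by simpa using hp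
  rw [partialSum_eq_sum, lpNorm_congr_ae (condExp_finsetSum
    (fun j _ => (memLp_seq hT hX j).integrable hp1) F₀)]
  exact lpNorm_sum_le (fun j _ => (memLp_seq hT hX j).condExp hp1) hp1

/-- By stationarity X_j - E_k X_j has the norm of X_0 - E_{k-j} X_0. The index k - j = 0 is absent
from the sum in the theorem and is bounded by 2‖X_0‖_p. -/
lemma lpNorm_partialSum_sub_condExp_le (hp : 1 ≤ p) (hT : MeasurePreserving T μ μ) (hle : F₀ ≤ mΩ)
    (hX : MemLp X₀ (ENNReal.ofReal p) μ) (k : ℕ) :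
    lpNorm (fun ω => partialSum T X₀ k ω - (μ[partialSum T X₀ k | pastSigma T F₀ k]) ω)
        (ENNReal.ofReal p) μ ≤
      2 * lpNorm X₀ (ENNReal.ofReal p) μ + ∑ j ∈ Finset.Icc 1 k,
        lpNorm (X₀ - μ[X₀ | pastSigma T F₀ j]) (ENNReal.ofReal p) μ := by
  have hp1 : 1 ≤ ENNReal.ofReal p := by simpa using hp
  set η : ℕ → ℝ := fun j => lpNorm (X₀ - μ[X₀ | pastSigma T F₀ j]) (ENNReal.ofReal p) μ with hη
  have hη0 : ∀ j, 0 ≤ η j := fun j => lpNorm_nonneg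
  have hη1 : η 0 ≤ 2 * lpNorm X₀ (ENNReal.ofReal p) μ := by
    have h1 := lpNorm_sub_le (g := μ[X₀ | pastSigma T F₀ 0]) hX hp1
    have h2 := hX.lpNorm_condExp_le_lpNorm (m := pastSigma T F₀ 0) hp1
    simp only [hη]; linarith
  have h1 : (fun ω => partialSum T X₀ k ω - (μ[partialSum T X₀ k | pastSigma T F₀ k]) ω) =ᵐ[μ]
      ∑ j ∈ Finset.Icc 1 k, (seq T X₀ j - μ[seq T X₀ j | pastSigma T F₀ k]) := by
    rw [partialSum_eq_sum]
    filter_upwards [condExp_finsetSum (s := Finset.Icc 1 k)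
      (fun j _ => (memLp_seq hT hX j).integrable hp1) (pastSigma T F₀ k)] with ω h
    rw [h]
    simp [Finset.sum_apply, Finset.sum_sub_distrib]
  rw [lpNorm_congr_ae h1]
  refine (lpNorm_sum_le (fun j _ =>
    (memLp_seq hT hX j).sub ((memLp_seq hT hX j).condExp hp1)) hp1).trans ?_
  have h2 : ∀ j ∈ Finset.Icc 1 k, lpNorm (seq T X₀ j - μ[seq T X₀ j | pastSigma T F₀ k])
      (ENNReal.ofReal p) μ = η (k - j) := by
    intro j hj
    have := lpNorm_sub_condExp_shift (P := ENNReal.ofReal p) hT hle (hX.integrable hp1) (k - j) j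
    rw [Nat.sub_add_cancel (Finset.mem_Icc.1 hj).2] at this
    exact this
  rw [Finset.sum_congr rfl h2]
  have h3 : ∑ j ∈ Finset.Icc 1 k, η (k - j) = ∑ i ∈ Finset.range k, η i := by
    rw [← Finset.sum_range_reflect, ← Finset.Ico_add_one_right_eq_Icc, Finset.sum_Ico_eq_sum_range]
    refine Finset.sum_congr (by simp) fun i hi => ?_
    congr 1
    have := Finset.mem_range.1 hi
    omega
  have h4 : ∑ i ∈ Finset.range k, η i ≤ ∑ i ∈ Finset.range (k + 1), η i :=
    Finset.sum_le_sum_of_subset_of_nonneg (Finset.range_subset_range.2 k.le_succ)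
      fun i _ _ => hη0 i
  have h5 : ∑ i ∈ Finset.range (k + 1), η i = η 0 + ∑ j ∈ Finset.Icc 1 k, η j := by
    rw [Finset.sum_range_succ', add_comm, ← Finset.Ico_add_one_right_eq_Icc,
      Finset.sum_Ico_eq_sum_range]
    congr 1
    exact Finset.sum_congr (by simp) fun i _ => by rw [add_comm]
  linarith

lemma abs_integral_le_lpNorm_condExp {q : ℝ} (hq : 1 ≤ q) (hle : F₀ ≤ mΩ) {Y : Ω → ℝ}
    (hY : MemLp Y (ENNReal.ofReal q) μ) :
    |∫ ω, Y ω ∂μ| ≤ lpNorm (μ[Y | F₀]) (ENNReal.ofReal q) μ := by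
  have hq1 : 1 ≤ ENNReal.ofReal q := by simpa using hq
  have hg : MemLp (μ[Y | F₀]) (ENNReal.ofReal q) μ := hY.condExp hq1
  rw [← integral_condExp hle, ← Real.norm_eq_abs]
  refine (norm_integral_le_integral_norm (μ := μ) (μ[Y | F₀])).trans ?_
  rw [← lpNorm_one_eq_integral_norm hg.1, ← toReal_eLpNorm hg.1, ← toReal_eLpNorm hg.1]
  exact ENNReal.toReal_mono hg.2.ne (eLpNorm_le_eLpNorm_of_exponent_le hq1 hg.1)

lemma lpNorm_const_prob {q : ℝ} (hq : 1 ≤ q) (c : ℝ) :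
    lpNorm (fun _ : Ω => c) (ENNReal.ofReal q) μ = |c| := by
  rw [lpNorm_const' (by simpa using by linarith) (by simp)]
  simp

lemma lpNorm_condExp_sub_integral_le {q : ℝ} (hq : 1 ≤ q) (hle : F₀ ≤ mΩ) {Y : Ω → ℝ}
    (hY : MemLp Y (ENNReal.ofReal q) μ) :
    lpNorm (fun ω => (μ[Y | F₀]) ω - ∫ ω', Y ω' ∂μ) (ENNReal.ofReal q) μ ≤
      2 * lpNorm (μ[Y | F₀]) (ENNReal.ofReal q) μ := by
  have hq1 : 1 ≤ ENNReal.ofReal q := by simpa using hq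
  have h1 := lpNorm_sub_le (g := fun _ : Ω => ∫ ω', Y ω' ∂μ) (hY.condExp (m := F₀) hq1) hq1
  rw [lpNorm_const_prob hq] at h1
  have h2 := abs_integral_le_lpNorm_condExp hq hle hY
  refine h1.trans ?_
  linarith

/-- Finiteness makes the passage to `toReal` lossless, and the explicit bound at j = 1 handles the
coefficient that (log 1)^γ = 0 removes from the series. -/
lemma coeffA_le (hp : 2 < p) (hT : MeasurePreserving T μ μ) (hle : F₀ ≤ mΩ)
    (hX : MemLp X₀ (ENNReal.ofReal p) μ) (j : ℕ) :
    coeffA T F₀ μ p X₀ j ≤ ENNReal.ofReal (2 * lpNorm X₀ (ENNReal.ofReal p) μ ^ 2) := by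
  have hp2' : 1 ≤ p / 2 := by linarith
  have hp2 : 1 ≤ ENNReal.ofReal (p / 2) := by simpa using hp2'
  have hY := memLp_seq_mul_seq hp hT hX
  refine max_le ?_ (iSup_le fun i => iSup_le fun _ => ?_)
  · rw [ENNReal.ofReal_mul zero_le_two, ENNReal.ofReal_ofNat]
    refine mul_le_mul_right (iSup_le fun i => ?_) _
    rw [normLp, ← ofReal_lpNorm ((hY i (j + i)).condExp hp2)]
    exact ENNReal.ofReal_le_ofReal (lpNorm_condExp_seq_mul_seq_le hp hT hX i (j + i))
  · have hg : MemLp (fun ω => (μ[fun ω' => seq T X₀ j ω' * seq T X₀ (j + i) ω' | F₀]) ω -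
        ∫ ω', seq T X₀ j ω' * seq T X₀ (j + i) ω' ∂μ) (ENNReal.ofReal (p / 2)) μ :=
      ((hY j (j + i)).condExp hp2).sub (memLp_const _)
    rw [normLp, ← ofReal_lpNorm hg]
    refine ENNReal.ofReal_le_ofReal ?_
    have h1 := lpNorm_condExp_sub_integral_le hp2' hle (hY j (j + i))
    have h2 := lpNorm_condExp_seq_mul_seq_le (F₀ := F₀) hp hT hX j (j + i)
    linarith

/-- After the mean is split off, the case i ≤ a is the centred half of A(X, a). For a ≤ i, centring
at most doubles the norm, which is the origin of the factor 2 in the other half of A(X, i). -/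
lemma lpNorm_condExp_seq_mul_seq_le_coeffA (hp : 2 < p) (hT : MeasurePreserving T μ μ)
    (hle : F₀ ≤ mΩ) (hX : MemLp X₀ (ENNReal.ofReal p) μ) (a i : ℕ) :
    lpNorm (μ[fun ω => seq T X₀ a ω * seq T X₀ (a + i) ω | F₀]) (ENNReal.ofReal (p / 2)) μ ≤
      |∫ ω, X₀ ω * seq T X₀ i ω ∂μ| + (coeffA T F₀ μ p X₀ (max a i)).toReal := by
  have hp2' : 1 ≤ p / 2 := by linarith
  have hp2 : 1 ≤ ENNReal.ofReal (p / 2) := by simpa using hp2'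
  have hY := memLp_seq_mul_seq hp hT hX a (a + i)
  have hg : MemLp (fun ω => (μ[fun ω => seq T X₀ a ω * seq T X₀ (a + i) ω | F₀]) ω -
      ∫ ω', seq T X₀ a ω' * seq T X₀ (a + i) ω' ∂μ) (ENNReal.ofReal (p / 2)) μ :=
    (hY.condExp hp2).sub (memLp_const _)
  have hfin : ∀ j, coeffA T F₀ μ p X₀ j ≠ ⊤ := fun j =>
    ((coeffA_le hp hT hle hX j).trans_lt ENNReal.ofReal_lt_top).ne
  have key : lpNorm (fun ω => (μ[fun ω => seq T X₀ a ω * seq T X₀ (a + i) ω | F₀]) ω -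
      ∫ ω', seq T X₀ a ω' * seq T X₀ (a + i) ω' ∂μ) (ENNReal.ofReal (p / 2)) μ ≤
      (coeffA T F₀ μ p X₀ (max a i)).toReal := by
    rcases le_total i a with h | h
    · rw [max_eq_left h, ← toReal_eLpNorm hg.1]
      refine ENNReal.toReal_mono (hfin a) (le_trans ?_ (le_max_right _ _))
      exact le_iSup₂_of_le i h le_rfl
    · rw [max_eq_right h]
      refine (lpNorm_condExp_sub_integral_le hp2' hle hY).trans ?_
      rw [← toReal_eLpNorm (hY.condExp hp2).1, ← ENNReal.toReal_ofNat 2, ← ENNReal.toReal_mul]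
      refine ENNReal.toReal_mono (hfin i) (le_trans ?_ (le_max_left _ _))
      refine mul_le_mul_right (le_iSup_of_le a ?_) _
      rw [add_comm a i]
      exact le_rfl
  have h1 := lpNorm_add_le' (f := fun ω => (μ[fun ω => seq T X₀ a ω * seq T X₀ (a + i) ω | F₀]) ω -
      ∫ ω', seq T X₀ a ω' * seq T X₀ (a + i) ω' ∂μ)
    (memLp_const (μ := μ) (p := ENNReal.ofReal (p / 2))
      (∫ ω', seq T X₀ a ω' * seq T X₀ (a + i) ω' ∂μ)) hp2
  rw [lpNorm_const_prob hp2', integral_seq_mul_seq hT hX.1] at h1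
  rw [integral_seq_mul_seq hT hX.1] at key
  have h2 : (fun ω => (μ[fun ω => seq T X₀ a ω * seq T X₀ (a + i) ω | F₀]) ω -
      ∫ ω', X₀ ω' * seq T X₀ i ω' ∂μ) + (fun _ => ∫ ω', X₀ ω' * seq T X₀ i ω' ∂μ) =
      μ[fun ω => seq T X₀ a ω * seq T X₀ (a + i) ω | F₀] := by
    ext ω; simp
  rw [h2] at h1
  linarith

/-- The conditional second moment of `S_k` in terms of covariances and the coefficients. -/
lemma lpNorm_condExp_partialSum_sq_le (hp : 2 < p) (hT : MeasurePreserving T μ μ)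
    (hle : F₀ ≤ mΩ) (hX : MemLp X₀ (ENNReal.ofReal p) μ) (k : ℕ) :
    lpNorm (μ[fun ω => partialSum T X₀ k ω ^ 2 | F₀]) (ENNReal.ofReal (p / 2)) μ ≤
      2 * (k * ∑ i ∈ Finset.range k, |∫ ω, X₀ ω * seq T X₀ i ω ∂μ|) +
      6 * ∑ j ∈ Finset.Icc 1 k, j * (coeffA T F₀ μ p X₀ j).toReal := by
  have hp2 : 1 ≤ ENNReal.ofReal (p / 2) := by simpa using (by linarith : 1 ≤ p / 2)
  have hY := memLp_seq_mul_seq hp hT hX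
  set β : ℕ → ℕ → ℝ := fun a b =>
    lpNorm (μ[fun ω => seq T X₀ a ω * seq T X₀ b ω | F₀]) (ENNReal.ofReal (p / 2)) μ with hβ
  have hsq : (fun ω => partialSum T X₀ k ω ^ 2) =
      ∑ q ∈ Finset.Icc 1 k ×ˢ Finset.Icc 1 k, fun ω => seq T X₀ q.1 ω * seq T X₀ q.2 ω := by
    ext ω
    rw [Finset.sum_apply, Finset.sum_product, sq, partialSum, Finset.sum_mul_sum]
  have h1 : lpNorm (μ[fun ω => partialSum T X₀ k ω ^ 2 | F₀]) (ENNReal.ofReal (p / 2)) μ ≤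
      ∑ a ∈ Finset.Icc 1 k, ∑ b ∈ Finset.Icc 1 k, β a b := by
    rw [hsq, lpNorm_congr_ae (condExp_finsetSum
      (fun q _ => (hY q.1 q.2).integrable hp2) F₀), ← Finset.sum_product']
    exact lpNorm_sum_le (fun q _ => (hY q.1 q.2).condExp hp2) hp2
  have h2 := sum_symm_le (β := β) (fun a b => lpNorm_nonneg)
    (fun a b => by simp only [hβ, mul_comm]) k
  have h3 : ∑ a ∈ Finset.Icc 1 k, ∑ i ∈ Finset.range k, β a (a + i) ≤
      ∑ a ∈ Finset.Icc 1 k, ∑ i ∈ Finset.range k,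
        (|∫ ω, X₀ ω * seq T X₀ i ω ∂μ| + (coeffA T F₀ μ p X₀ (max a i)).toReal) :=
    Finset.sum_le_sum fun a _ => Finset.sum_le_sum fun i _ =>
      lpNorm_condExp_seq_mul_seq_le_coeffA hp hT hle hX a i
  have h4 := sum_max_le (A := fun j => (coeffA T F₀ μ p X₀ j).toReal)
    (fun j => ENNReal.toReal_nonneg) k
  simp only [Finset.sum_add_distrib, Finset.sum_const, Nat.card_Icc, Nat.add_sub_cancel,
    nsmul_eq_mul] at h3
  linarith

end Coefficients

/-! ### Deterministic assembly of the estimates. -/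

section Assembly

lemma exists_dyadic_sum_le_unweighted {s : ℝ} (hs : 0 < s) :
    ∃ A : ℝ, 0 ≤ A ∧ ∀ (R n : ℕ) (d : ℕ → ℝ), 1 ≤ n → (∀ j, 0 ≤ d j) → (∀ l < R, 2 ^ l ≤ n) →
      ∑ l ∈ Finset.range R, ((2 : ℝ) ^ l) ^ (-s) * ∑ j ∈ Finset.Icc 1 (2 ^ l), d j ≤
        A * ∑ j ∈ Finset.Icc (1 : ℕ) n, (j : ℝ) ^ (-s) * d j := by
  obtain ⟨A, hA, h⟩ := exists_dyadic_sum_le (γ := 0) le_rfl hs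
  refine ⟨2 * A, by positivity, fun R n d hn1 hd hn => ?_⟩
  have h1 := h R n d hd hn
  simp only [Real.rpow_zero, one_mul, mul_one] at h1
  have h2 : d 1 ≤ ∑ j ∈ Finset.Icc (1 : ℕ) n, (j : ℝ) ^ (-s) * d j := by
    have := Finset.single_le_sum (s := Finset.Icc 1 n) (f := fun j : ℕ => (j : ℝ) ^ (-s) * d j)
      (fun j _ => mul_nonneg (by positivity) (hd j)) (Finset.mem_Icc.2 ⟨le_rfl, hn1⟩)
    simpa using this
  nlinarith

/-- The recurrence for the moments along the powers of two, after rescaling. -/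
lemma rescaled_recurrence {p a a' u e b ε c : ℝ} (hp : 2 < p) (ha : 0 ≤ a) (hu : 0 ≤ u)
    (he : 0 ≤ e) (hb : 0 ≤ b) (hε : 0 ≤ ε) (hc : 0 ≤ c) (l : ℕ)
    (h : a' ≤ ((2 + ε) * a ^ p + p * (a ^ (p - 1) * u) + c * (a ^ (p - 2) * b)) ^ (1 / p) + e) :
    ((2 : ℝ) ^ (l + 1)) ^ (-(1 / p)) * a' ≤
      ((1 + ε / 2) * (((2 : ℝ) ^ l) ^ (-(1 / p)) * a) ^ p +
        p / 2 * ((((2 : ℝ) ^ l) ^ (-(1 / p)) * a) ^ (p - 1) * (((2 : ℝ) ^ l) ^ (-(1 / p)) * u)) +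
        c / 2 * ((((2 : ℝ) ^ l) ^ (-(1 / p)) * a) ^ (p - 2) *
          (((2 : ℝ) ^ l) ^ (-(2 / p)) * b))) ^ (1 / p) + ((2 : ℝ) ^ l) ^ (-(1 / p)) * e := by
  have hp0 : 0 < p := by linarith
  set x : ℝ := (2 : ℝ) ^ l with hx
  have hx0 : 0 < x := by positivity
  have hx2 : (2 : ℝ) ^ (l + 1) = 2 * x := by rw [pow_succ]; ring
  rw [hx2]
  have e1 : (x ^ (-(1 / p)) * a) ^ p = x⁻¹ * a ^ p := by
    rw [Real.mul_rpow (by positivity) ha, ← Real.rpow_mul hx0.le, neg_mul,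
      one_div_mul_cancel hp0.ne', Real.rpow_neg_one]
  have e2 : (x ^ (-(1 / p)) * a) ^ (p - 1) * (x ^ (-(1 / p)) * u) = x⁻¹ * (a ^ (p - 1) * u) := by
    rw [Real.mul_rpow (by positivity) ha, ← Real.rpow_mul hx0.le, ← Real.rpow_neg_one]
    rw [show x ^ (-(1 / p) * (p - 1)) * a ^ (p - 1) * (x ^ (-(1 / p)) * u) =
      (x ^ (-(1 / p) * (p - 1)) * x ^ (-(1 / p))) * (a ^ (p - 1) * u) by ring,
      ← Real.rpow_add hx0]
    congr 2
    field_simp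
    ring
  have e3 : (x ^ (-(1 / p)) * a) ^ (p - 2) * (x ^ (-(2 / p)) * b) = x⁻¹ * (a ^ (p - 2) * b) := by
    rw [Real.mul_rpow (by positivity) ha, ← Real.rpow_mul hx0.le, ← Real.rpow_neg_one]
    rw [show x ^ (-(1 / p) * (p - 2)) * a ^ (p - 2) * (x ^ (-(2 / p)) * b) =
      (x ^ (-(1 / p) * (p - 2)) * x ^ (-(2 / p))) * (a ^ (p - 2) * b) by ring,
      ← Real.rpow_add hx0]
    congr 2
    field_simp
    ring
  rw [e1, e2, e3]
  set W := (2 + ε) * a ^ p + p * (a ^ (p - 1) * u) + c * (a ^ (p - 2) * b) with hW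
  have hW0 : 0 ≤ W := by positivity
  have e4 : (1 + ε / 2) * (x⁻¹ * a ^ p) + p / 2 * (x⁻¹ * (a ^ (p - 1) * u)) +
      c / 2 * (x⁻¹ * (a ^ (p - 2) * b)) = (2 * x)⁻¹ * W := by
    rw [hW, mul_inv]; ring
  rw [e4, Real.mul_rpow (by positivity) hW0, Real.inv_rpow (by positivity),
    ← Real.rpow_neg (by positivity)]
  have h1 : (2 * x) ^ (-(1 / p)) ≤ x ^ (-(1 / p)) :=
    Real.rpow_le_rpow_of_nonpos hx0 (by linarith) (by simp; positivity)
  calc (2 * x) ^ (-(1 / p)) * a' ≤ (2 * x) ^ (-(1 / p)) * (W ^ (1 / p) + e) := by gcongr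
    _ = (2 * x) ^ (-(1 / p)) * W ^ (1 / p) + (2 * x) ^ (-(1 / p)) * e := by ring
    _ ≤ _ := by gcongr

lemma rpow_half_add_le {x y z : ℝ} (hx : 0 ≤ x) (hy : 0 ≤ y) (hz : 0 ≤ z) :
    (x ^ 2 + y + z) ^ (1 / 2 : ℝ) ≤ x + y ^ (1 / 2 : ℝ) + z ^ (1 / 2 : ℝ) := by
  have h1 := Real.rpow_add_le_add_rpow (p := 1 / 2) (add_nonneg (sq_nonneg x) hy) hz
    (by norm_num) (by norm_num)
  have h2 := Real.rpow_add_le_add_rpow (p := 1 / 2) (sq_nonneg x) hy (by norm_num) (by norm_num)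
  have h3 : (x ^ 2) ^ (1 / 2 : ℝ) = x := by rw [← Real.sqrt_eq_rpow, Real.sqrt_sq hx]
  linarith

/-- The weighted second order terms of the recurrence. -/
lemma exists_second_order_sum_le {p γ : ℝ} (hp : 2 < p)
    (hγ : (p ≤ 3 ∧ γ = 0) ∨ (3 < p ∧ p - 3 < γ)) :
    ∃ D : ℝ, 0 ≤ D ∧ ∀ (R n : ℕ) (b A : ℕ → ℝ) (V Λ : ℝ), 0 ≤ V → 0 ≤ Λ → (∀ j, 0 ≤ A j) →
      (∀ l < R, 2 ^ l ≤ n) → b 0 ≤ V ^ 2 → A 1 ≤ 2 * V ^ 2 →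
      (∀ l < R, b l ≤ 2 * ((2 : ℝ) ^ l * Λ) + 6 * ∑ j ∈ Finset.Icc (1 : ℕ) (2 ^ l), j * A j) →
      ∃ ε w : ℕ → ℝ, (∀ l, Absorbs p (ε l) (w l)) ∧ ∑ l ∈ Finset.range R, ε l ≤ 1 ∧
        ∑ l ∈ Finset.range R, w l * (((2 : ℝ) ^ l) ^ (-(2 / p)) * b l) ≤
          D * (V ^ 2 + ((2 : ℝ) ^ R) ^ (1 - 2 / p) * Λ +
            ∑ j ∈ Finset.Icc (1 : ℕ) n, 1 / (j : ℝ) ^ (2 / p - 1) * Real.log j ^ γ * A j) := by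
  have hp0 : 0 < p := by linarith
  have hγ0 : 0 ≤ γ := by rcases hγ with ⟨_, rfl⟩ | ⟨_, _⟩ <;> linarith
  have hθ : 0 < 1 - 2 / p := by rw [sub_pos, div_lt_one hp0]; exact hp
  -- The covariance part grows like 2^{l(1-2/p)} = ρ^{2l}. A weight ρ^{R-l} turns this into ρ^{R+l},
  -- still geometrically increasing, so the sum over l < R is of order ρ^{2R} without a logarithm.
  set ρ : ℝ := 2 ^ ((1 - 2 / p) / 2) with hρdef
  have hρ : 1 < ρ := Real.one_lt_rpow one_lt_two (by linarith)
  have hρ0 : 0 < ρ := by linarith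
  have hρ2 : ∀ l : ℕ, ((2 : ℝ) ^ l) ^ (1 - 2 / p) = ρ ^ l * ρ ^ l := fun l => by
    rw [← pow_add, hρdef, ← Real.rpow_natCast, ← Real.rpow_natCast, ← Real.rpow_mul zero_le_two,
      ← Real.rpow_mul zero_le_two]
    congr 1; push_cast; ring
  obtain ⟨D, hD, hweights⟩ := exists_absorbing_weights hγ hρ
  obtain ⟨B, hB, hdyadic⟩ := exists_dyadic_sum_le hγ0 (by positivity : 0 < 2 / p)
  have hρ1 : 0 < ρ - 1 := by linarith
  refine ⟨D * (1 + 2 / (ρ - 1) + 18 * B), by positivity,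
    fun R n b A V Λ hV hΛ hA hn hb0 hA1 hb => ?_⟩
  obtain ⟨ε, w, habs, hε, hw0, hw1, hw2⟩ := hweights R
  refine ⟨ε, w, habs, hε, ?_⟩
  have hwn : ∀ l, 0 ≤ w l := fun l => zero_le_one.trans (habs l).2.1
  set Q := ∑ j ∈ Finset.Icc (1 : ℕ) n, 1 / (j : ℝ) ^ (2 / p - 1) * Real.log j ^ γ * A j with hQ
  have hQ0 : 0 ≤ Q := Finset.sum_nonneg fun j _ => by
    have := hA j
    have := Real.log_natCast_nonneg j
    positivity
  have hS0 : ∀ l : ℕ, 0 ≤ ∑ j ∈ Finset.Icc (1 : ℕ) (2 ^ l), (j : ℝ) * A j := fun l =>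
    Finset.sum_nonneg fun j _ => mul_nonneg (Nat.cast_nonneg j) (hA j)
  have hterm : ∀ l ∈ Finset.range R, w l * (((2 : ℝ) ^ l) ^ (-(2 / p)) * b l) ≤
      (if l = 0 then D * V ^ 2 else 0) + 2 * D * Λ * ρ ^ R * ρ ^ l +
      6 * D * (((l : ℝ) ^ γ * ((2 : ℝ) ^ l) ^ (-(2 / p))) *
        ∑ j ∈ Finset.Icc (1 : ℕ) (2 ^ l), (j : ℝ) * A j) := by
    intro l hl
    have hlR := Finset.mem_range.1 hl
    have hS := hS0 l
    have t2 : 0 ≤ 2 * D * Λ * ρ ^ R * ρ ^ l := by positivity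
    have t3 : 0 ≤ 6 * D * (((l : ℝ) ^ γ * ((2 : ℝ) ^ l) ^ (-(2 / p))) *
        ∑ j ∈ Finset.Icc (1 : ℕ) (2 ^ l), (j : ℝ) * A j) := by positivity
    -- Scale 0 uses the crude bound b_0 ≤ V², as the weight bound l^γ is unavailable there.
    rcases Nat.eq_zero_or_pos l with h0 | h0
    · subst h0
      rw [if_pos rfl]
      have : w 0 * (((2 : ℝ) ^ 0) ^ (-(2 / p)) * b 0) ≤ D * V ^ 2 := by
        rw [pow_zero, Real.one_rpow, one_mul]
        exact (mul_le_mul_of_nonneg_left hb0 (hwn 0)).trans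
          (mul_le_mul_of_nonneg_right hw0 (sq_nonneg V))
      linarith
    · rw [if_neg h0.ne', zero_add]
      have hx : (0 : ℝ) < 2 ^ l := by positivity
      have e1 : ((2 : ℝ) ^ l) ^ (-(2 / p)) * (2 : ℝ) ^ l = ρ ^ l * ρ ^ l := by
        rw [← hρ2, ← Real.rpow_add_one hx.ne']; congr 1; ring
      have e2 : ρ ^ (R - l) * ρ ^ l = ρ ^ R := by rw [← pow_add]; congr 1; omega
      have g1 : w l * (2 * (((2 : ℝ) ^ l) ^ (-(2 / p)) * (2 : ℝ) ^ l) * Λ) ≤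
          2 * D * Λ * ρ ^ R * ρ ^ l := by
        rw [e1]
        calc w l * (2 * (ρ ^ l * ρ ^ l) * Λ)
            ≤ (D * ρ ^ (R - l)) * (2 * (ρ ^ l * ρ ^ l) * Λ) := by gcongr; exact hw2 l
          _ = 2 * D * Λ * (ρ ^ (R - l) * ρ ^ l) * ρ ^ l := by ring
          _ = _ := by rw [e2]
      have g2 : w l * (6 * ((((2 : ℝ) ^ l) ^ (-(2 / p))) *
          ∑ j ∈ Finset.Icc (1 : ℕ) (2 ^ l), (j : ℝ) * A j)) ≤
          6 * D * (((l : ℝ) ^ γ * ((2 : ℝ) ^ l) ^ (-(2 / p))) *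
            ∑ j ∈ Finset.Icc (1 : ℕ) (2 ^ l), (j : ℝ) * A j) := by
        calc _ ≤ (D * (l : ℝ) ^ γ) * (6 * ((((2 : ℝ) ^ l) ^ (-(2 / p))) *
            ∑ j ∈ Finset.Icc (1 : ℕ) (2 ^ l), (j : ℝ) * A j)) := by gcongr; exact hw1 l h0
          _ = _ := by ring
      have g3 : w l * (((2 : ℝ) ^ l) ^ (-(2 / p)) * b l) ≤ w l * (((2 : ℝ) ^ l) ^ (-(2 / p)) *
          (2 * ((2 : ℝ) ^ l * Λ) + 6 * ∑ j ∈ Finset.Icc (1 : ℕ) (2 ^ l), (j : ℝ) * A j)) :=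
        mul_le_mul_of_nonneg_left (mul_le_mul_of_nonneg_left (hb l hlR) (by positivity)) (hwn l)
      linarith
  refine (Finset.sum_le_sum hterm).trans ?_
  rw [Finset.sum_add_distrib, Finset.sum_add_distrib, ← Finset.mul_sum, ← Finset.mul_sum]
  have s1 : ∑ l ∈ Finset.range R, (if l = 0 then D * V ^ 2 else 0) ≤ D * V ^ 2 := by
    rw [Finset.sum_ite_eq' (Finset.range R) 0]
    split_ifs
    · exact le_rfl
    · positivity
  have s2 : ∑ l ∈ Finset.range R, ρ ^ l ≤ ρ ^ R / (ρ - 1) := by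
    rw [geom_sum_eq hρ.ne']
    gcongr
    linarith
  have s3 := hdyadic R n (fun j => j * A j) (fun j => mul_nonneg (Nat.cast_nonneg j) (hA j)) hn
  have s4 : ∑ j ∈ Finset.Icc (1 : ℕ) n, (j : ℝ) ^ (-(2 / p)) * Real.log j ^ γ * (j * A j) = Q := by
    refine Finset.sum_congr rfl fun j hj => ?_
    have hj0 : (0 : ℝ) < j := by exact_mod_cast (Finset.mem_Icc.1 hj).1
    have : 1 / (j : ℝ) ^ (2 / p - 1) = (j : ℝ) ^ (-(2 / p)) * j := by
      rw [one_div, ← Real.rpow_neg hj0.le, ← Real.rpow_add_one hj0.ne']; congr 1; ring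
    rw [this]; ring
  rw [s4, Nat.cast_one, one_mul] at s3
  have s5 : 2 * D * Λ * ρ ^ R * ∑ l ∈ Finset.range R, ρ ^ l ≤
      D * (2 / (ρ - 1)) * (((2 : ℝ) ^ R) ^ (1 - 2 / p) * Λ) := by
    rw [hρ2]
    calc _ ≤ 2 * D * Λ * ρ ^ R * (ρ ^ R / (ρ - 1)) := by gcongr
      _ = _ := by ring
  have s6 : 6 * D * ∑ l ∈ Finset.range R, ((l : ℝ) ^ γ * ((2 : ℝ) ^ l) ^ (-(2 / p))) *
      ∑ j ∈ Finset.Icc (1 : ℕ) (2 ^ l), (j : ℝ) * A j ≤ 6 * D * (B * (2 * V ^ 2 + Q)) := by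
    refine mul_le_mul_of_nonneg_left (s3.trans ?_) (by positivity)
    gcongr
  set L := ((2 : ℝ) ^ R) ^ (1 - 2 / p) * Λ with hL
  have hL0 : 0 ≤ L := by positivity
  have c1 : 0 ≤ D * (2 / (ρ - 1)) * (V ^ 2 + Q) := by positivity
  have c2 : 0 ≤ D * (L + Q) := by positivity
  have c3 : 0 ≤ D * B * (6 * V ^ 2 + 18 * L + 12 * Q) := by positivity
  linarith

end Assembly

section Assembly

lemma two_pow_sub_rpow {R l : ℕ} (h : l ≤ R) (t : ℝ) :
    ((2 : ℝ) ^ (R - l)) ^ t = ((2 : ℝ) ^ R) ^ t * ((2 : ℝ) ^ l) ^ (-t) := by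
  have : (2 : ℝ) ^ R = 2 ^ (R - l) * 2 ^ l := by rw [← pow_add]; congr 1; omega
  rw [this, Real.mul_rpow (by positivity) (by positivity), mul_assoc,
    ← Real.rpow_add (by positivity), add_neg_cancel, Real.rpow_zero, mul_one]

lemma combine_bounds {p B G V V₀ SU SE M LQ y U E E' s : ℝ} (hp : 0 ≤ p) (hB : 0 ≤ B) (hG : 0 ≤ G)
    (hV : 0 ≤ V) (hSU : 0 ≤ SU) (hSE : 0 ≤ SE) (hM : 0 ≤ M) (hLQ : 0 ≤ LQ)
    (hy : y ≤ 2 * (V₀ + p * (U + E') + s)) (hV₀ : V₀ ≤ V) (hs : s ≤ G * (V + M + LQ))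
    (hU : U ≤ B * SU) (hE : E ≤ B * (2 * V + SE)) (hE' : E' ≤ B * (2 * V + SE)) :
    2 * y + 2 * U + 3 * E ≤ (4 + (4 * p + 2) * B + 2 * (4 * p + 3) * B + 4 * G) *
      (M + V + SU + SE + LQ) := by
  have h1 : p * (U + E') ≤ p * (B * SU + B * (2 * V + SE)) := by gcongr
  have h2 : 2 * y + 2 * U + 3 * E ≤ 4 * (V + p * (B * SU + B * (2 * V + SE)) +
      G * (V + M + LQ)) + 2 * (B * SU) + 3 * (B * (2 * V + SE)) := by linarith
  refine h2.trans ?_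
  have hpB : 0 ≤ p * B := by positivity
  have k1 : 0 ≤ (4 + (4 * p + 2) * B) * (M + SE + LQ) := by positivity
  have k2 : 0 ≤ (2 * (4 * p + 3) * B) * (M + SU + LQ) := by positivity
  have k3 : 0 ≤ (4 * G) * (SU + SE) := by positivity
  have k4 : 0 ≤ (4 * p + 3) * B * SE := by positivity
  have k5 : 0 ≤ 4 * SU := by positivity
  have k6 : 0 ≤ (4 * p + 2) * B * V := by positivity
  linarith

lemma rescale_bound {H V SU SE LΛ LQ Nt Nr Nh nt nh : ℝ} (hH : 0 ≤ H) (hV : 0 ≤ V)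
    (hSU : 0 ≤ SU) (hSE : 0 ≤ SE) (hLΛ : 0 ≤ LΛ) (hLQ : 0 ≤ LQ) (hmul : Nt * Nr = Nh)
    (hNt : Nt ≤ 2 * nt) (hNh : Nh ≤ 2 * nh) :
    Nt * (H * (Nr * LΛ + V + SU + SE + LQ)) ≤
      2 * H * (nh * LΛ + nt * V + nt * SU + nt * SE + nt * LQ) := by
  calc Nt * (H * (Nr * LΛ + V + SU + SE + LQ))
      = H * (Nt * Nr * LΛ + Nt * V + Nt * SU + Nt * SE + Nt * LQ) := by ring
    _ ≤ H * (2 * nh * LΛ + 2 * nt * V + 2 * nt * SU + 2 * nt * SE + 2 * nt * LQ) := by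
        rw [hmul]; gcongr
    _ = _ := by ring

/-- The deterministic part of the argument: solving the dyadic recurrence. -/
lemma exists_moment_bound {p γ : ℝ} (hp : 2 < p)
    (hγ : (p ≤ 3 ∧ γ = 0) ∨ (3 < p ∧ p - 3 < γ)) :
    ∃ C : ℝ, 0 ≤ C ∧ ∀ (R n : ℕ) (a u e b A dU dE : ℕ → ℝ) (V Λ : ℝ),
      1 ≤ n → (∀ l < R, 2 ^ l ≤ n) → 2 ^ R ≤ 2 * n → 0 ≤ V → 0 ≤ Λ →
      (∀ l, 0 ≤ a l) → (∀ l, 0 ≤ u l) → (∀ l, 0 ≤ e l) → (∀ l, 0 ≤ b l) →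
      (∀ j, 0 ≤ A j) → (∀ j, 0 ≤ dU j) → (∀ j, 0 ≤ dE j) →
      a 0 ≤ V → b 0 ≤ V ^ 2 → A 1 ≤ 2 * V ^ 2 →
      (∀ l, u l ≤ ∑ j ∈ Finset.Icc (1 : ℕ) (2 ^ l), dU j) →
      (∀ l, e l ≤ 2 * V + ∑ j ∈ Finset.Icc (1 : ℕ) (2 ^ l), dE j) →
      (∀ l < R, b l ≤ 2 * ((2 : ℝ) ^ l * Λ) + 6 * ∑ j ∈ Finset.Icc (1 : ℕ) (2 ^ l), j * A j) →
      (∀ ε w, Absorbs p ε w → ∀ l, a (l + 1) ≤ ((2 + ε) * a l ^ p + p * (a l ^ (p - 1) * u l) +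
        taylorConst p * w * (a l ^ (p - 2) * b l)) ^ (1 / p) + e l) →
      2 * a R + ∑ l ∈ Finset.range R, 2 * (((2 : ℝ) ^ (R - l)) ^ (1 / p) * u l) +
        ∑ l ∈ Finset.range (R + 1), 3 * (((2 : ℝ) ^ (R - l)) ^ (1 / p) * e l) ≤
      C * ((n : ℝ) ^ (1 / 2 : ℝ) * Λ ^ (1 / 2 : ℝ) + (n : ℝ) ^ (1 / p) * V +
        (n : ℝ) ^ (1 / p) * ∑ j ∈ Finset.Icc (1 : ℕ) n, 1 / (j : ℝ) ^ (1 / p) * dU j +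
        (n : ℝ) ^ (1 / p) * ∑ j ∈ Finset.Icc (1 : ℕ) (2 * n), 1 / (j : ℝ) ^ (1 / p) * dE j +
        (n : ℝ) ^ (1 / p) * (∑ j ∈ Finset.Icc (1 : ℕ) n,
          1 / (j : ℝ) ^ (2 / p - 1) * Real.log j ^ γ * A j) ^ (1 / 2 : ℝ)) := by
  have hp0 : 0 < p := by linarith
  set t := 1 / p with ht
  have ht0 : 0 < t := by positivity
  obtain ⟨D, hD, hsecond⟩ := exists_second_order_sum_le hp hγ
  obtain ⟨B, hB, hdyadic⟩ := exists_dyadic_sum_le_unweighted ht0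
  have hT0 := taylorConst_nonneg hp
  set G := (taylorConst p * D) ^ (1 / 2 : ℝ) with hG
  have hG0 : 0 ≤ G := by positivity
  refine ⟨2 * (4 + (4 * p + 2) * B + 2 * (4 * p + 3) * B + 4 * G), by positivity, ?_⟩
  intro R n a u e b A dU dE V Λ hn1 hn hRn hV hΛ ha hu he hb hA hdU hdE ha0 hb0 hA1 hU hE hbl hrec
  obtain ⟨ε, w, habs, hε, hsum⟩ := hsecond R n b A V Λ hV hΛ hA hn hb0 hA1 hbl
  set Q := ∑ j ∈ Finset.Icc (1 : ℕ) n, 1 / (j : ℝ) ^ (2 / p - 1) * Real.log j ^ γ * A j with hQ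
  have hQ0 : 0 ≤ Q := Finset.sum_nonneg fun j _ => by
    have := hA j
    have := Real.log_natCast_nonneg j
    positivity
  have hrpow : ∀ j : ℕ, 1 / (j : ℝ) ^ t = (j : ℝ) ^ (-t) := fun j => by
    rw [one_div, Real.rpow_neg (Nat.cast_nonneg j)]
  simp only [hrpow]
  set SU := ∑ j ∈ Finset.Icc (1 : ℕ) n, (j : ℝ) ^ (-t) * dU j with hSU
  set SE := ∑ j ∈ Finset.Icc (1 : ℕ) (2 * n), (j : ℝ) ^ (-t) * dE j with hSE
  have hSU0 : 0 ≤ SU := Finset.sum_nonneg fun j _ => mul_nonneg (by positivity) (hdU j)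
  have hSE0 : 0 ≤ SE := Finset.sum_nonneg fun j _ => mul_nonneg (by positivity) (hdE j)
  set x : ℕ → ℝ := fun l => ((2 : ℝ) ^ l) ^ (-t) with hx
  have hx0 : ∀ l, 0 ≤ x l := fun l => by positivity
  -- the rescaled sums
  have hUsum : ∑ l ∈ Finset.range R, x l * u l ≤ B * SU :=
    (Finset.sum_le_sum fun l _ => mul_le_mul_of_nonneg_left (hU l) (hx0 l)).trans
      (hdyadic R n dU hn1 hdU hn)
  have hEsum : ∑ l ∈ Finset.range (R + 1), x l * e l ≤ B * (2 * V + SE) := by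
    -- The constant 2V is charged to the index j = 1, so that the whole error bound is a sum over j
    -- ≤ 2^l.
    set d : ℕ → ℝ := fun j => (if j = 1 then 2 * V else 0) + dE j with hd
    have hd0 : ∀ j, 0 ≤ d j := fun j => by
      have := hdE j
      simp only [hd]; split_ifs <;> positivity
    have h1 : ∀ l, e l ≤ ∑ j ∈ Finset.Icc (1 : ℕ) (2 ^ l), d j := fun l => by
      refine (hE l).trans (le_of_eq ?_)
      rw [Finset.sum_add_distrib, Finset.sum_ite_eq', if_pos]
      exact Finset.mem_Icc.2 ⟨le_rfl, Nat.one_le_two_pow⟩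
    -- The errors include the scale l = R, where 2^R may exceed n; hence the range up to 2n in the
    -- theorem.
    have h2 : ∀ l < R + 1, 2 ^ l ≤ 2 * n := fun l hl =>
      (Nat.pow_le_pow_right two_pos (by omega)).trans hRn
    refine (Finset.sum_le_sum fun l _ => mul_le_mul_of_nonneg_left (h1 l) (hx0 l)).trans
      ((hdyadic (R + 1) (2 * n) d (by omega) hd0 h2).trans (le_of_eq ?_))
    congr 1
    simp only [hd, mul_add, mul_ite, mul_zero]
    rw [Finset.sum_add_distrib, Finset.sum_ite_eq', if_pos (Finset.mem_Icc.2 ⟨le_rfl, by omega⟩)]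
    simp [hSE]
  have hEsum' : ∑ l ∈ Finset.range R, x l * e l ≤ B * (2 * V + SE) :=
    (Finset.sum_le_sum_of_subset_of_nonneg (Finset.range_subset_range.2 R.le_succ)
      fun l _ _ => mul_nonneg (hx0 l) (he l)).trans hEsum
  -- the recurrence
  have hα := le_of_dyadic_recurrence (R := R) (α := fun l => x l * a l)
    (u := fun l => x l * u l) (e := fun l => x l * e l)
    (b := fun l => ((2 : ℝ) ^ l) ^ (-(2 / p)) * b l) (ε := ε) (w := w) hp hT0
    (fun l => mul_nonneg (hx0 l) (ha l)) (fun l => mul_nonneg (hx0 l) (hu l))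
    (fun l => mul_nonneg (hx0 l) (he l)) (fun l => mul_nonneg (by positivity) (hb l))
    (fun l => (habs l).1) (fun l => zero_le_one.trans (habs l).2.1) hε
    (fun l _ => rescaled_recurrence hp (ha l) (hu l) (he l) (hb l) (habs l).1
      (mul_nonneg hT0 (zero_le_one.trans (habs l).2.1)) l (hrec _ _ (habs l) l)) (le_refl R)
  have ha0' : x 0 * a 0 ≤ V := by simpa [hx] using ha0
  set N : ℝ := (2 : ℝ) ^ R with hN
  have hN0 : 0 < N := by positivity
  have hsq : (taylorConst p * ∑ l ∈ Finset.range R, w l * (((2 : ℝ) ^ l) ^ (-(2 / p)) * b l))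
      ^ (1 / 2 : ℝ) ≤ G * (V + N ^ (1 / 2 - t) * Λ ^ (1 / 2 : ℝ) + Q ^ (1 / 2 : ℝ)) := by
    have hs0 : 0 ≤ ∑ l ∈ Finset.range R, w l * (((2 : ℝ) ^ l) ^ (-(2 / p)) * b l) :=
      Finset.sum_nonneg fun l _ => mul_nonneg (zero_le_one.trans (habs l).2.1)
        (mul_nonneg (by positivity) (hb l))
    have h1 := Real.rpow_le_rpow (mul_nonneg hT0 hs0) (mul_le_mul_of_nonneg_left hsum hT0)
      (by norm_num : (0 : ℝ) ≤ 1 / 2)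
    refine h1.trans ?_
    rw [← mul_assoc, Real.mul_rpow (by positivity) (by positivity)]
    refine mul_le_mul_of_nonneg_left ?_ hG0
    refine (rpow_half_add_le hV (by positivity) hQ0).trans (le_of_eq ?_)
    rw [Real.mul_rpow (by positivity) hΛ, ← Real.rpow_mul hN0.le]
    congr 4
    rw [ht]; ring
  have hnR : (1 : ℝ) ≤ n := by exact_mod_cast hn1
  have hN2 : N ≤ 2 * n := by
    have : ((2 ^ R : ℕ) : ℝ) ≤ ((2 * n : ℕ) : ℝ) := Nat.cast_le.2 hRn
    push_cast at this
    exact this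
  have hscale : ∀ s : ℝ, 0 ≤ s → s ≤ 1 → N ^ s ≤ 2 * (n : ℝ) ^ s := by
    intro s hs0 hs1
    refine (Real.rpow_le_rpow hN0.le hN2 hs0).trans ?_
    rw [Real.mul_rpow zero_le_two (by linarith)]
    have : (2 : ℝ) ^ s ≤ 2 ^ (1 : ℝ) := Real.rpow_le_rpow_of_exponent_le one_le_two hs1
    rw [Real.rpow_one] at this
    gcongr
  have ht1 : t ≤ 1 := by rw [ht, div_le_one hp0]; linarith
  have hNt := hscale t ht0.le ht1
  have hNh := hscale (1 / 2) (by norm_num) (by norm_num)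
  have hNmul : N ^ t * N ^ (1 / 2 - t) = N ^ (1 / 2 : ℝ) := by
    rw [← Real.rpow_add hN0]; congr 1; ring
  have e1 : 2 * a R = N ^ t * (2 * (x R * a R)) := by
    have : N ^ t * x R = 1 := by
      rw [hx, ← Real.rpow_add hN0, add_neg_cancel, Real.rpow_zero]
    linear_combination (-2 * a R) * this
  have e2 : ∑ l ∈ Finset.range R, 2 * (((2 : ℝ) ^ (R - l)) ^ t * u l) =
      N ^ t * (2 * ∑ l ∈ Finset.range R, x l * u l) := by
    simp only [Finset.mul_sum]
    refine Finset.sum_congr rfl fun l hl => ?_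
    rw [two_pow_sub_rpow (Finset.mem_range.1 hl).le]; ring
  have e3 : ∑ l ∈ Finset.range (R + 1), 3 * (((2 : ℝ) ^ (R - l)) ^ t * e l) =
      N ^ t * (3 * ∑ l ∈ Finset.range (R + 1), x l * e l) := by
    simp only [Finset.mul_sum]
    refine Finset.sum_congr rfl fun l hl => ?_
    rw [two_pow_sub_rpow (Nat.lt_succ_iff.1 (Finset.mem_range.1 hl))]; ring
  rw [e1, e2, e3]
  set LΛ := Λ ^ (1 / 2 : ℝ) with hLΛ
  set LQ := Q ^ (1 / 2 : ℝ) with hLQ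
  have hLΛ0 : 0 ≤ LΛ := by positivity
  have hLQ0 : 0 ≤ LQ := by positivity
  have hNt0 : 0 ≤ N ^ t := by positivity
  set H := 4 + (4 * p + 2) * B + 2 * (4 * p + 3) * B + 4 * G with hH
  have hH0 : 0 ≤ H := by positivity
  have hbig : 2 * (x R * a R) + 2 * ∑ l ∈ Finset.range R, x l * u l +
      3 * ∑ l ∈ Finset.range (R + 1), x l * e l ≤
      H * (N ^ (1 / 2 - t) * LΛ + V + SU + SE + LQ) := by
    exact combine_bounds hp0.le hB hG0 hV hSU0 hSE0 (by positivity) hLQ0 hα ha0' hsq hUsum hEsum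
      hEsum'
  rw [← mul_add, ← mul_add]
  refine (mul_le_mul_of_nonneg_left hbig hNt0).trans ?_
  exact rescale_bound hH0 hV hSU0 hSE0 hLΛ0 hLQ0 hNmul hNt hNh

end Assembly

/-! ### The inequality in real-valued norms. -/

section Main

variable {Ω : Type*} {F₀ mΩ : MeasurableSpace Ω} {μ : Measure Ω} {T : Ω → Ω} {X₀ : Ω → ℝ} {p : ℝ}

lemma memLp_maxAbsPartialSum {P : ℝ≥0∞} (hT : MeasurePreserving T μ μ) (hX : MemLp X₀ P μ)
    (n : ℕ) (hn : 1 ≤ n) : MemLp (maxAbsPartialSum T X₀ n hn) P μ := by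
  have h : maxAbsPartialSum T X₀ n hn =
      (Finset.Icc 1 n).sup' (Finset.nonempty_Icc.2 hn) fun j ω => |partialSum T X₀ j ω| := by
    ext ω; rw [Finset.sup'_apply]; rfl
  rw [h]
  exact Finset.sup'_induction (p := fun f => MemLp f P μ) _ _ (fun f hf g hg => hf.sup hg)
    fun j _ => (memLp_partialSum hT hX j).abs

/-- The maximal inequality with real-valued norms. -/
lemma exists_lpNorm_maxAbsPartialSum_le {p γ : ℝ} (hp : 2 < p)
    (hγ : (p ≤ 3 ∧ γ = 0) ∨ (3 < p ∧ p - 3 < γ)) :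
    ∃ C : ℝ, 0 ≤ C ∧ ∀ (Ω : Type u) (F₀ : MeasurableSpace Ω) (mΩ : MeasurableSpace Ω)
      (μ : Measure Ω) (_ : IsProbabilityMeasure μ) (T : Ω → Ω) (_ : MeasurePreserving T μ μ)
      (_ : F₀ ≤ mΩ) (_ : F₀ ≤ F₀.comap T) (X₀ : Ω → ℝ) (_ : MemLp X₀ (ENNReal.ofReal p) μ)
      (n : ℕ) (hn : 1 ≤ n),
      lpNorm (maxAbsPartialSum T X₀ n hn) (ENNReal.ofReal p) μ ≤
        C * ((n : ℝ) ^ (1 / 2 : ℝ) *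
              (∑ k ∈ Finset.range n, |∫ ω, X₀ ω * seq T X₀ k ω ∂μ|) ^ (1 / 2 : ℝ) +
          (n : ℝ) ^ (1 / p) * lpNorm (seq T X₀ 1) (ENNReal.ofReal p) μ +
          (n : ℝ) ^ (1 / p) * ∑ k ∈ Finset.Icc (1 : ℕ) n, 1 / (k : ℝ) ^ (1 / p) *
            lpNorm (μ[seq T X₀ k | F₀]) (ENNReal.ofReal p) μ +
          (n : ℝ) ^ (1 / p) * ∑ k ∈ Finset.Icc (1 : ℕ) (2 * n), 1 / (k : ℝ) ^ (1 / p) *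
            lpNorm (X₀ - μ[X₀ | pastSigma T F₀ k]) (ENNReal.ofReal p) μ +
          (n : ℝ) ^ (1 / p) * (∑ k ∈ Finset.Icc (1 : ℕ) n,
            1 / (k : ℝ) ^ (2 / p - 1) * Real.log k ^ γ *
              (coeffA T F₀ μ p X₀ k).toReal) ^ (1 / 2 : ℝ)) := by
  obtain ⟨C, hC, hbound⟩ := exists_moment_bound hp hγ
  refine ⟨C, hC, fun Ω F₀ mΩ μ _ T hT hle hF X₀ hX n hn => ?_⟩
  have hp1 : 1 ≤ p := by linarith
  -- Minimality of R gives both 2^l ≤ n for l < R and 2^R ≤ 2n.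
  set R := Nat.clog 2 n with hR
  have hnR : n ≤ 2 ^ R := Nat.le_pow_clog one_lt_two n
  have hlt : ∀ l < R, 2 ^ l ≤ n := fun l hl => by
    by_contra! h
    exact absurd (Nat.clog_le_of_le_pow h.le) (by omega)
  have hR2 : 2 ^ R ≤ 2 * n := by
    rcases Nat.eq_zero_or_pos R with h | h
    · rw [h]; omega
    · have h1 := hlt (R - 1) (by omega)
      have h2 : 2 ^ R = 2 * 2 ^ (R - 1) := by rw [← pow_succ']; congr 1; omega
      omega
  have hA1 : ∀ j, (coeffA T F₀ μ p X₀ j).toReal ≤ 2 * lpNorm X₀ (ENNReal.ofReal p) μ ^ 2 :=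
    fun j => ENNReal.toReal_le_of_le_ofReal (mul_nonneg zero_le_two (sq_nonneg _))
      (coeffA_le hp hT hle hX j)
  rw [lpNorm_seq hT hX 1]
  refine (lpNorm_maxAbsPartialSum_le hp.le hT hle hF hX hn hnR).trans ?_
  refine hbound R n (fun l => lpNorm (partialSum T X₀ (2 ^ l)) (ENNReal.ofReal p) μ)
    (fun l => lpNorm (μ[partialSum T X₀ (2 ^ l) | F₀]) (ENNReal.ofReal p) μ)
    (fun l => lpNorm (fun ω => partialSum T X₀ (2 ^ l) ω -
      (μ[partialSum T X₀ (2 ^ l) | pastSigma T F₀ (2 ^ l)]) ω) (ENNReal.ofReal p) μ)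
    (fun l => lpNorm (μ[fun ω => partialSum T X₀ (2 ^ l) ω ^ 2 | F₀]) (ENNReal.ofReal (p / 2)) μ)
    (fun j => (coeffA T F₀ μ p X₀ j).toReal)
    (fun j => lpNorm (μ[seq T X₀ j | F₀]) (ENNReal.ofReal p) μ)
    (fun j => lpNorm (X₀ - μ[X₀ | pastSigma T F₀ j]) (ENNReal.ofReal p) μ)
    (lpNorm X₀ (ENNReal.ofReal p) μ) (∑ k ∈ Finset.range n, |∫ ω, X₀ ω * seq T X₀ k ω ∂μ|)
    hn hlt hR2 lpNorm_nonneg (Finset.sum_nonneg fun k _ => abs_nonneg _)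
    (fun l => lpNorm_nonneg) (fun l => lpNorm_nonneg) (fun l => lpNorm_nonneg)
    (fun l => lpNorm_nonneg) (fun j => ENNReal.toReal_nonneg) (fun j => lpNorm_nonneg)
    (fun j => lpNorm_nonneg) ?_ ?_ (hA1 1) ?_ ?_ ?_ ?_
  · rw [pow_zero, partialSum_one, lpNorm_seq hT hX]
  · exact lpNorm_condExp_partialSum_one_sq_le hp hT hX
  · exact fun l => lpNorm_condExp_partialSum_le hp1 hT hX (2 ^ l)
  · exact fun l => lpNorm_partialSum_sub_condExp_le hp1 hT hle hX (2 ^ l)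
  · intro l hl
    have h1 := lpNorm_condExp_partialSum_sq_le hp hT hle hX (2 ^ l)
    rw [Nat.cast_pow, Nat.cast_ofNat] at h1
    refine h1.trans ?_
    gcongr
    exact hlt l hl
  · intro ε w h l
    have h1 := lpNorm_partialSum_double_le hp h hT hle hX (2 ^ l)
    rwa [show 2 ^ l + 2 ^ l = 2 ^ (l + 1) by rw [pow_succ]; ring] at h1

end Main

/-! ### Passage to norms with values in [0, ∞]. -/

lemma natCast_rpow_eq_ofReal (n : ℕ) {s : ℝ} (hs : 0 ≤ s) :
    (n : ℝ≥0∞) ^ s = ENNReal.ofReal ((n : ℝ) ^ s) := by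
  rw [← ENNReal.ofReal_rpow_of_nonneg (Nat.cast_nonneg n) hs, ENNReal.ofReal_natCast]

end StationaryMax

theorem mainTheorem8 (p γ : ℝ) (hp : 2 < p)
    (hγ : (p ≤ 3 ∧ γ = 0) ∨ (3 < p ∧ p - 3 < γ)) :
    ∃ C : ℝ≥0, ∀ (Ω : Type u) (F₀ : MeasurableSpace Ω) (mΩ : MeasurableSpace Ω)
      (μ : Measure Ω) (_ : IsProbabilityMeasure μ)
      (T : Ω ≃ᵐ Ω) (_ : MeasurePreserving T μ μ)
      (_ : F₀ ≤ mΩ) (_ : F₀ ≤ F₀.comap T)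
      (X₀ : Ω → ℝ) (_ : MemLp X₀ (ENNReal.ofReal p) μ)
      (n : ℕ) (hn : 1 ≤ n),
      StationaryMax.normLp μ p (StationaryMax.maxAbsPartialSum T X₀ n hn) ≤
        (C : ℝ≥0∞) *
          ( (n : ℝ≥0∞) ^ (1 / 2 : ℝ) *
              (∑ k ∈ Finset.range n,
                ENNReal.ofReal |∫ ω, X₀ ω * StationaryMax.seq T X₀ k ω ∂μ|) ^ (1 / 2 : ℝ)
          + (n : ℝ≥0∞) ^ (1 / p) * StationaryMax.normLp μ p (StationaryMax.seq T X₀ 1)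
          + (n : ℝ≥0∞) ^ (1 / p) *
              ∑ k ∈ Finset.Icc 1 n, ENNReal.ofReal (1 / (k : ℝ) ^ (1 / p)) *
                StationaryMax.normLp μ p (μ[StationaryMax.seq T X₀ k | F₀])
          + (n : ℝ≥0∞) ^ (1 / p) *
              ∑ k ∈ Finset.Icc 1 (2 * n), ENNReal.ofReal (1 / (k : ℝ) ^ (1 / p)) *
                StationaryMax.normLp μ p (X₀ - μ[X₀ | StationaryMax.pastSigma T F₀ k])
          + (n : ℝ≥0∞) ^ (1 / p) *
              (∑ k ∈ Finset.Icc 1 n,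
                ENNReal.ofReal (1 / (k : ℝ) ^ (2 / p - 1) * Real.log k ^ γ) *
                  StationaryMax.coeffA T F₀ μ p X₀ k) ^ (1 / 2 : ℝ) ) := by
  obtain ⟨C, hC, hbound⟩ := StationaryMax.exists_lpNorm_maxAbsPartialSum_le.{u} hp hγ
  refine ⟨C.toNNReal, fun Ω F₀ mΩ μ _ T hT hle hF X₀ hX n hn => ?_⟩
  have h := hbound Ω F₀ mΩ μ inferInstance T hT hle hF X₀ hX n hn
  have hp0 : 0 < p := by linarith
  have hp1 : 1 ≤ ENNReal.ofReal p := by simpa using (by linarith : 1 ≤ p)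
  have hlog : ∀ k : ℕ, 0 ≤ 1 / (k : ℝ) ^ (2 / p - 1) * Real.log k ^ γ := fun k => by
    have := Real.log_natCast_nonneg k
    positivity
  have hC' : (C.toNNReal : ℝ≥0∞) = ENNReal.ofReal C := rfl
  have e0 : ∑ k ∈ Finset.range n,
      ENNReal.ofReal |∫ ω, X₀ ω * StationaryMax.seq T X₀ k ω ∂μ| =
      ENNReal.ofReal (∑ k ∈ Finset.range n,
        |∫ ω, X₀ ω * StationaryMax.seq T X₀ k ω ∂μ|) :=
    (ENNReal.ofReal_sum_of_nonneg fun k _ => abs_nonneg _).symm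
  have e1 : ∑ k ∈ Finset.Icc 1 n, ENNReal.ofReal (1 / (k : ℝ) ^ (1 / p)) *
      StationaryMax.normLp μ p (μ[StationaryMax.seq T X₀ k | F₀]) =
      ENNReal.ofReal (∑ k ∈ Finset.Icc (1 : ℕ) n, 1 / (k : ℝ) ^ (1 / p) *
        lpNorm (μ[StationaryMax.seq T X₀ k | F₀]) (ENNReal.ofReal p) μ) := by
    rw [ENNReal.ofReal_sum_of_nonneg fun k _ => mul_nonneg (by positivity) lpNorm_nonneg]
    refine Finset.sum_congr rfl fun k _ => ?_
    rw [ENNReal.ofReal_mul (by positivity),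
      ofReal_lpNorm ((StationaryMax.memLp_seq hT hX k).condExp hp1), StationaryMax.normLp]
  have e2 : ∑ k ∈ Finset.Icc 1 (2 * n), ENNReal.ofReal (1 / (k : ℝ) ^ (1 / p)) *
      StationaryMax.normLp μ p (X₀ - μ[X₀ | StationaryMax.pastSigma T F₀ k]) =
      ENNReal.ofReal (∑ k ∈ Finset.Icc (1 : ℕ) (2 * n), 1 / (k : ℝ) ^ (1 / p) *
        lpNorm (X₀ - μ[X₀ | StationaryMax.pastSigma T F₀ k]) (ENNReal.ofReal p) μ) := by
    rw [ENNReal.ofReal_sum_of_nonneg fun k _ => mul_nonneg (by positivity) lpNorm_nonneg]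
    refine Finset.sum_congr rfl fun k _ => ?_
    rw [ENNReal.ofReal_mul (by positivity), ofReal_lpNorm (hX.sub (hX.condExp hp1)),
      StationaryMax.normLp]
  have e3 : ∑ k ∈ Finset.Icc 1 n,
      ENNReal.ofReal (1 / (k : ℝ) ^ (2 / p - 1) * Real.log k ^ γ) *
        StationaryMax.coeffA T F₀ μ p X₀ k =
      ENNReal.ofReal (∑ k ∈ Finset.Icc (1 : ℕ) n, 1 / (k : ℝ) ^ (2 / p - 1) * Real.log k ^ γ *
        (StationaryMax.coeffA T F₀ μ p X₀ k).toReal) := by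
    rw [ENNReal.ofReal_sum_of_nonneg fun k _ => mul_nonneg (hlog k) ENNReal.toReal_nonneg]
    refine Finset.sum_congr rfl fun k _ => ?_
    rw [ENNReal.ofReal_mul (hlog k), ENNReal.ofReal_toReal
      ((StationaryMax.coeffA_le hp hT hle hX k).trans_lt ENNReal.ofReal_lt_top).ne]
  have hs0 : 0 ≤ ∑ k ∈ Finset.range n, |∫ ω, X₀ ω * StationaryMax.seq T X₀ k ω ∂μ| :=
    Finset.sum_nonneg fun k _ => abs_nonneg _
  have hs1 : 0 ≤ ∑ k ∈ Finset.Icc (1 : ℕ) n, 1 / (k : ℝ) ^ (1 / p) *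
      lpNorm (μ[StationaryMax.seq T X₀ k | F₀]) (ENNReal.ofReal p) μ :=
    Finset.sum_nonneg fun k _ => mul_nonneg (by positivity) lpNorm_nonneg
  have hs2 : 0 ≤ ∑ k ∈ Finset.Icc (1 : ℕ) (2 * n), 1 / (k : ℝ) ^ (1 / p) *
      lpNorm (X₀ - μ[X₀ | StationaryMax.pastSigma T F₀ k]) (ENNReal.ofReal p) μ :=
    Finset.sum_nonneg fun k _ => mul_nonneg (by positivity) lpNorm_nonneg
  have hs3 : 0 ≤ ∑ k ∈ Finset.Icc (1 : ℕ) n, 1 / (k : ℝ) ^ (2 / p - 1) * Real.log k ^ γ *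
      (StationaryMax.coeffA T F₀ μ p X₀ k).toReal :=
    Finset.sum_nonneg fun k _ => mul_nonneg (hlog k) ENNReal.toReal_nonneg
  have hX1 : 0 ≤ lpNorm (StationaryMax.seq T X₀ 1) (ENNReal.ofReal p) μ := lpNorm_nonneg
  rw [e0, e1, e2, e3, hC', StationaryMax.natCast_rpow_eq_ofReal n (by norm_num : (0 : ℝ) ≤ 1 / 2),
    StationaryMax.natCast_rpow_eq_ofReal n (by positivity : 0 ≤ 1 / p), StationaryMax.normLp,
    StationaryMax.normLp, ← ofReal_lpNorm (StationaryMax.memLp_maxAbsPartialSum hT hX n hn),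
    ← ofReal_lpNorm (StationaryMax.memLp_seq hT hX 1),
    ENNReal.ofReal_rpow_of_nonneg hs0 (by norm_num), ENNReal.ofReal_rpow_of_nonneg hs3 (by norm_num),
    ← ENNReal.ofReal_mul (by positivity), ← ENNReal.ofReal_mul (by positivity),
    ← ENNReal.ofReal_mul (by positivity), ← ENNReal.ofReal_mul (by positivity),
    ← ENNReal.ofReal_mul (by positivity), ← ENNReal.ofReal_add (by positivity) (by positivity),
    ← ENNReal.ofReal_add (by positivity) (by positivity),
    ← ENNReal.ofReal_add (by positivity) (by positivity),
    ← ENNReal.ofReal_add (by positivity) (by positivity), ← ENNReal.ofReal_mul hC]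
  exact ENNReal.ofReal_le_ofReal h
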